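/- **Definitions.** Let $\mathrm{C}_5$ be the cyclic group of order $5$. A $\mathrm{C}_5$-simplicial complex is a finite simplicial complex with a simplicial action of $\mathrm{C}_5$ on it. A weak $\mathrm{C}_5$-isomorphism $K_1\to K_2$ of $\mathrm{C}_5$-simplicial complexes is a pair $(f,\varphi)$ such that $f\colon K_1\to K_2$ is an isomorphism of simplicial complexes, $\varphi$ is an automorphism of $\mathrm{C}_5$, and $f(gv)=\varphi(g)f(v)$ for all $g\in\mathrm{C}_5$ and all vertices $v$ of $K_1$. A finite simplicial complex $K$ is a $\mathbb{Z}$-homology $d$-manifold if every simplex of $K$ is contained in a $d$-simplex of $K$ and, for each nonempty simplex $\sigma\in K$ with $\dim\sigma<d$, there is an isomorphism of graded groups $H_*(\mathrm{link}(\sigma,K);\mathbb{Z})\cong H_*(S^{d-\dim\sigma-1};\mathbb{Z})$. It is a $\mathbb{Z}$-homology $d$-sphere if, moreover, $H_*(K;\mathbb{Z})\cong H_*(S^d;\mathbb{Z})$. **Proposition 5.2.** Up to weak $\mathrm{C}_5$-isomorphism, there are exactly nine $10$-vertex $\mathrm{C}_5$-simplicial complexes $L$ such that 1. $L$ is a $\mathbb{Z}$-homology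 $3$-sphere, 2. the vertex set of $L$ splits into two $\mathrm{C}_5$-orbits of length $5$, 3. at least one of these two orbits does not contain any $2$-simplex of $L$. They are the following complexes $L_1,\ldots,L_9$: each $L_i$ satisfies (1)–(3), no two of them are weakly $\mathrm{C}_5$-isomorphic, and every $10$-vertex $\mathrm{C}_5$-simplicial complex that satisfies (1)–(3) is weakly $\mathrm{C}_5$-isomorphic to one of them. The vertex set of each $L_i$ is $\{1,\ldots,10\}$, a generator of $\mathrm{C}_5$ acts on it by the permutation $(1\ 2\ 3\ 4\ 5)(6\ 7\ 8\ 9\ 10)$, and $L_i$ consists of all faces of the $3$-simplices in the $\mathrm{C}_5$-orbits of the following representatives: - $L_1$: $\{1,2,3,6\},\ \{1,2,4,6\},\ \{1,3,4,6\},\ \{2,3,4,6\}$; - $L_2$: $\{1,2,6,7\},\ \{2,3,6,7\},\ \{3,4,6,7\},\ \{4,5,6,7\},\ \{1,5,6,7\}$; - $L_3$: $\{1,3,6,7\},\ \{3,5,6,7\},\ \{2,5,6,7\},\ \{2,4,6,7\},\ \{1,4,6,7\}$; - $L_4$: $\{1,2,6,7\},\ \{2,3,6,7\},\ \{1,3,6,7\},\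 \{1,3,5,6\},\ \{2,3,5,6\}$; - $L_5$: $\{1,2,6,7\},\ \{2,3,6,7\},\ \{3,4,6,7\},\ \{1,4,6,7\},\ \{1,3,4,6\},\ \{1,3,5,6\}$; - $L_6$: $\{1,2,6,7\},\ \{2,3,6,7\},\ \{3,4,6,7\},\ \{1,4,6,7\},\ \{1,4,5,6\},\ \{3,4,5,6\}$; - $L_7$: $\{1,3,6,7\},\ \{2,3,6,7\},\ \{2,4,6,7\},\ \{1,4,6,7\},\ \{1,2,4,6\},\ \{2,3,5,6\}$; - $L_8$: $\{1,2,6,7\},\ \{2,3,6,7\},\ \{1,3,6,7\},\ \{2,3,6,8\},\ \{3,5,6,8\},\ \{2,5,6,8\}$; - $L_9$: $\{1,2,6,7\},\ \{2,3,6,7\},\ \{3,4,6,7\},\ \{1,4,6,7\},\ \{1,3,6,8\},\ \{3,5,6,8\},\ \{1,5,6,8\}$. -/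

import Mathlib

/-!
Simplicial complexes are Mathlib's `AbstractSimplicialComplex V` (finite nonempty faces, closed under
passing to nonempty subsets, every element of `V` is a vertex). Links need not use all vertices and
are therefore `PreAbstractSimplicialComplex V`.
-/

universe u v

namespace SimplicialHomology

variable {V : Type u}

/-- The link of `σ` in `K`: the nonempty sets `τ`, disjoint from `σ`, such that `τ ∪ σ` is a face. -/
def link [DecidableEq V] (K : PreAbstractSimplicialComplex V) (σ : Finset V) :
    PreAbstractSimplicialComplex V where
  faces := {τ | τ.Nonempty ∧ Disjoint τ σ ∧ τ ∪ σ ∈ K}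
  isRelLowerSet_faces := by
    rintro τ ⟨hne, hd, hK⟩
    refine ⟨hne, fun ρ hρ hρne => ⟨hρne, hd.mono_left hρ, ?_⟩⟩
    exact (K.isRelLowerSet_faces hK).2 (Finset.union_subset_union_left hρ)
      (hρne.mono Finset.subset_union_left)

/-- The module of oriented simplicial `n`-chains of `K` with coefficients in `R` (`V` is finite).
A chain is recorded by its coefficients: `c v` is the coefficient of the oriented simplex
`[v 0, …, v n]`. So `c` lives on tuples of pairwise different vertices that span a simplex of `K`,
and it changes by the sign of the permutation when the vertices are permuted. -/
def chains (R : Type v) [CommRing R] (K : PreAbstractSimplicialComplex V) (n : ℕ) :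
    Submodule R ((Fin (n + 1) → V) → R) where
  carrier := {c |
    (∀ v, c v ≠ 0 → ∃ h : Function.Injective v, Finset.univ.map ⟨v, h⟩ ∈ K) ∧
    ∀ (π : Equiv.Perm (Fin (n + 1))) (v), c (v ∘ π) = (Equiv.Perm.sign π : ℤ) • c v}
  zero_mem' := by simp
  add_mem' := by
    rintro a b ⟨ha, ha'⟩ ⟨hb, hb'⟩
    refine ⟨fun v hv => ?_, fun π v => by simp [ha', hb', smul_add]⟩
    by_cases h : a v = 0
    · exact hb v (fun h' => hv (by simp [h, h']))
    · exact ha v h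
  smul_mem' := by
    rintro r a ⟨ha, ha'⟩
    refine ⟨fun v hv => ha v (fun h => hv (by simp [h])), fun π v => ?_⟩
    simp only [Pi.smul_apply, ha']
    exact smul_comm _ _ _

/-- The simplicial boundary operator `∂ [v₀, …, vₘ] = ∑ᵢ (-1)ⁱ [v₀, …, v̂ᵢ, …, vₘ]` in terms of the
coefficients: that of `[v₁, …, vₘ]` in `∂ c` is the sum over all `w` of that of
`[w, v₁, …, vₘ]` in `c`. -/
def boundary (R : Type v) [CommRing R] (V : Type u) [Fintype V] (m : ℕ) :
    ((Fin (m + 1) → V) → R) →ₗ[R] ((Fin m → V) → R) where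
  toFun c v := ∑ w : V, c (Fin.cons w v)
  map_add' a b := by ext v; simp [Finset.sum_add_distrib]
  map_smul' r a := by ext v; simp [Finset.mul_sum]

/-- Simplicial `n`-cycles; every `0`-chain is a cycle (the homology is not reduced). -/
def cycles (R : Type v) [CommRing R] [Fintype V] (K : PreAbstractSimplicialComplex V) :
    (n : ℕ) → Submodule R ((Fin (n + 1) → V) → R)
  | 0 => chains R K 0
  | n + 1 => chains R K (n + 1) ⊓ LinearMap.ker (boundary R V (n + 1))

/-- Simplicial `n`-boundaries. -/
def boundaries (R : Type v) [CommRing R] [Fintype V] (K : PreAbstractSimplicialComplex V) (n : ℕ) :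
    Submodule R ((Fin (n + 1) → V) → R) :=
  (chains R K (n + 1)).map (boundary R V (n + 1))

/-- The simplicial homology module `H_n(K; R)`: cycles modulo boundaries. -/
abbrev Homology (R : Type v) [CommRing R] [Fintype V] (K : PreAbstractSimplicialComplex V)
    (n : ℕ) : Type (max u v) :=
  cycles R K n ⧸ (boundaries R K n).submoduleOf (cycles R K n)

/-- `H_*(K; R) ≅ H_*(S^m; R)` as graded modules. The module `H_n(S^m; R)` is free, of rank one
for `n = 0 ≠ m` and for `n = m ≠ 0`, of rank two for `n = m = 0`, and zero in all other degrees. -/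
def HasHomologyOfSphere (R : Type v) [CommRing R] [Fintype V]
    (K : PreAbstractSimplicialComplex V) (m : ℕ) : Prop :=
  ∀ n : ℕ, Nonempty
    (Homology R K n ≃ₗ[R] (Fin ((if n = 0 then 1 else 0) + (if n = m then 1 else 0)) → R))

/-- `K` is an `R`-homology `d`-manifold. A face `σ` has dimension `σ.card - 1`, so the
sphere that is compared with its link has dimension `d - σ.card`. -/
structure IsHomologyManifold (R : Type v) [CommRing R] [Fintype V] [DecidableEq V]
    (K : PreAbstractSimplicialComplex V) (d : ℕ) : Prop where
  pure : ∀ σ ∈ K, ∃ τ ∈ K, σ ⊆ τ ∧ τ.card = d + 1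
  link : ∀ σ ∈ K, σ.card ≤ d → HasHomologyOfSphere R (link K σ) (d - σ.card)

/-- `K` is an `R`-homology `d`-sphere. -/
def IsHomologySphere (R : Type v) [CommRing R] [Fintype V] [DecidableEq V]
    (K : PreAbstractSimplicialComplex V) (d : ℕ) : Prop :=
  IsHomologyManifold R K d ∧ HasHomologyOfSphere R K d

end SimplicialHomology

namespace EquivariantComplex

/-- The action of `G` on the vertices is simplicial, that is, it makes `K` a `G`-simplicial
complex. -/
def IsSimplicialAction (G : Type u) [Group G] {V : Type v} [DecidableEq V] [MulAction G V]
    (K : AbstractSimplicialComplex V) : Prop :=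
  ∀ (g : G), ∀ σ ∈ K, σ.image (fun x => g • x) ∈ K

/-- The `G`-simplicial complexes `K` and `L` are weakly `G`-isomorphic: there are an isomorphism
`f : K → L` of simplicial complexes and an automorphism `φ` of `G` with `f (g x) = φ(g) f(x)`. -/
def WeaklyIsomorphic (G : Type u) [Group G] {V : Type*} {W : Type*} [MulAction G V] [MulAction G W]
    (K : AbstractSimplicialComplex V) (L : AbstractSimplicialComplex W) : Prop :=
  ∃ (f : V ≃ W) (φ : G ≃* G), (∀ σ : Finset V, σ ∈ K ↔ σ.map f.toEmbedding ∈ L) ∧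
    ∀ (g : G) (x : V), f (g • x) = φ g • f x

/-- The cyclic group of order five. -/
abbrev C5 : Type := Multiplicative (ZMod 5)

/-- `K` is a ten-vertex `C5`-simplicial complex that is a `ℤ`-homology `3`-sphere, whose vertices
form two orbits of length five, at least one of which contains no `2`-simplex of `K`. -/
structure IsTwoOrbitSphere {V : Type u} [Fintype V] [DecidableEq V] [MulAction C5 V]
    (K : AbstractSimplicialComplex V) : Prop where
  card_eq : Fintype.card V = 10
  simplicial : IsSimplicialAction C5 K
  sphere : SimplicialHomology.IsHomologySphere ℤ K.toPreAbstractSimplicialComplex 3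
  orbits : ∃ a b : V, MulAction.orbit C5 a ∪ MulAction.orbit C5 b = Set.univ ∧
    Disjoint (MulAction.orbit C5 a) (MulAction.orbit C5 b) ∧
    (MulAction.orbit C5 a).ncard = 5 ∧ (MulAction.orbit C5 b).ncard = 5
  no_triangle : ∃ a : V, ∀ σ ∈ K, σ.card = 3 → ¬ (σ : Set V) ⊆ MulAction.orbit C5 a

/-- The vertex set `{1, …, 10}`; the element `10` of `Fin 10` is the same as `0`. -/
abbrev W : Type := Fin 10

/-- The permutation `(1 2 3 4 5)(6 7 8 9 10)`. -/
def rotation : Equiv.Perm W := c[1, 2, 3, 4, 5] * c[6, 7, 8, 9, 10]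

/-- The generator of `C5` acts on `{1, …, 10}` by the permutation `(1 2 3 4 5)(6 7 8 9 10)`. -/
instance : MulAction C5 W where
  smul g x := (rotation ^ (Multiplicative.toAdd g).val) x
  one_smul := by decide
  mul_smul := by decide

/-- Representatives of the `C5`-orbits of `3`-simplices of the nine complexes. -/
def representatives : Fin 9 → Finset (Finset W) := ![
  {{1, 2, 3, 6}, {1, 2, 4, 6}, {1, 3, 4, 6}, {2, 3, 4, 6}},
  {{1, 2, 6, 7}, {2, 3, 6, 7}, {3, 4, 6, 7}, {4, 5, 6, 7}, {1, 5, 6, 7}},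
  {{1, 3, 6, 7}, {3, 5, 6, 7}, {2, 5, 6, 7}, {2, 4, 6, 7}, {1, 4, 6, 7}},
  {{1, 2, 6, 7}, {2, 3, 6, 7}, {1, 3, 6, 7}, {1, 3, 5, 6}, {2, 3, 5, 6}},
  {{1, 2, 6, 7}, {2, 3, 6, 7}, {3, 4, 6, 7}, {1, 4, 6, 7}, {1, 3, 4, 6}, {1, 3, 5, 6}},
  {{1, 2, 6, 7}, {2, 3, 6, 7}, {3, 4, 6, 7}, {1, 4, 6, 7}, {1, 4, 5, 6}, {3, 4, 5, 6}},
  {{1, 3, 6, 7}, {2, 3, 6, 7}, {2, 4, 6, 7}, {1, 4, 6, 7}, {1, 2, 4, 6}, {2, 3, 5, 6}},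
  {{1, 2, 6, 7}, {2, 3, 6, 7}, {1, 3, 6, 7}, {2, 3, 6, 8}, {3, 5, 6, 8}, {2, 5, 6, 8}},
  {{1, 2, 6, 7}, {2, 3, 6, 7}, {3, 4, 6, 7}, {1, 4, 6, 7}, {1, 3, 6, 8}, {3, 5, 6, 8},
    {1, 5, 6, 8}}]

/-- The complexes `L_1, …, L_9` (indexed by `0, …, 8`): the `3`-simplices are all the translates of
the representatives under `C5`, and the simplices are the nonempty subsets of these. -/
def L (i : Fin 9) : AbstractSimplicialComplex W where
  faces := {σ | σ.Nonempty ∧ ∃ τ ∈ representatives i, ∃ g : C5, σ ⊆ τ.image (fun x => g • x)}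
  isRelLowerSet_faces := by
    rintro σ ⟨hne, τ, hτ, g, h⟩
    exact ⟨hne, fun ρ hρ hρne => ⟨hρne, τ, hτ, g, hρ.trans h⟩⟩
  singleton_mem := by
    intro x
    refine ⟨Finset.singleton_nonempty x, ?_⟩
    revert i x
    decide

end EquivariantComplex

/-! Classification. Label the vertices so that `6, …, 10` is an orbit without triangles. Then a
tetrahedron has at most two vertices there, so it lies in one of 1 + 10 + 20 = 31 orbits of
four-element sets. Since the complex is pure, it is determined by the set of orbits that occur, a
31-bit number (`stateOf`). The link of a triangle has the homology of `S^0`, so every triangle lies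
in no or in exactly two tetrahedra; this gives one condition for each of the 22 orbits of triangles
outside the second vertex orbit. A pruned search (`search_isKnown`, `search_sound`) runs through all
solutions. Up to the 20 relabellings `x ↦ k x` in the first orbit and `x ↦ k x + t` in the second, a
solution is one of the nine complexes, or one of the numbers `0` and `1`, whose complexes miss the
vertex `6`, or an entry of `obstructions`. In the last case the complex or the link of a vertex
carries an integral 1-cocycle with nonzero sum along a closed path of three edges, which contradicts
`H_1 = 0` (`period_eq_zero_of_hasHomologyOfSphere`). Only the consequences of sphericity in
`IsSphereLike` are used in this direction.

Existence. Each `L i` and each link of a face with at most three vertices collapses to a vertex once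
a suitable facet is removed. Collapses preserve acyclicity (`IsAcyclic.of_collapse`), and restoring
a top-dimensional facet to an acyclic complex gives the homology of a sphere
(`hasHomologyOfSphere_of_isAcyclic_erase`).

Distinctness. A weak isomorphism is determined by an exponent `k` and the images of `1` and `6`.
After composition with an element of `C5` only 80 maps remain, and for `i ≠ j` none of them takes
the facets of `L i` to facets of `L j`.

Sets of vertices are encoded as 10-bit masks, and complexes as numbers whose binary digits are
indexed by masks, so that all finite checks are arithmetic on natural numbers. -/

namespace SimplicialHomology

open Finset

/-! ### Oriented chains and the boundary operator. -/

section Chains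

variable {V : Type u} {K K₀ : PreAbstractSimplicialComplex V} {n : ℕ}

theorem chains_mono (h : ∀ σ ∈ K₀, σ ∈ K) : chains ℤ K₀ n ≤ chains ℤ K n := by
  rintro c ⟨h₁, h₂⟩
  refine ⟨fun v hv => ?_, h₂⟩
  obtain ⟨hi, hm⟩ := h₁ v hv
  exact ⟨hi, h _ hm⟩

theorem mem_chains_of_forall_eq_zero {c : (Fin (n + 1) → V) → ℤ} (hc : c ∈ chains ℤ K n)
    (h : ∀ (v : Fin (n + 1) → V) (hv : Function.Injective v),
      univ.map ⟨v, hv⟩ ∈ K → univ.map ⟨v, hv⟩ ∉ K₀ → c v = 0) : c ∈ chains ℤ K₀ n := by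
  refine ⟨fun v hv => ?_, hc.2⟩
  obtain ⟨hi, hm⟩ := hc.1 v hv
  exact ⟨hi, by_contra fun h' => hv (h v hi hm h')⟩

theorem exists_perm_of_map_eq {u v : Fin n → V} (hu : Function.Injective u)
    (hv : Function.Injective v) (h : univ.map ⟨u, hu⟩ = univ.map ⟨v, hv⟩) :
    ∃ π : Equiv.Perm (Fin n), u = v ∘ π := by
  have hr : ∀ i, ∃ j, v j = u i := by
    intro i
    have : u i ∈ univ.map ⟨v, hv⟩ := by
      rw [← h]
      simp
    simpa using this
  choose f hf using hr
  have hfi : Function.Injective f := fun i j hij => hu (by rw [← hf i, ← hf j, hij])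
  exact ⟨Equiv.ofBijective f (Finite.injective_iff_bijective.1 hfi), by
    ext i
    simp [hf]⟩

/-- Two orderings of one simplex differ by a permutation, which changes the coefficient only by a
sign. Vanishing on a simplex can thus be tested on a single ordering. -/
theorem eq_zero_of_map_eq {c : (Fin (n + 1) → V) → ℤ} (hc : c ∈ chains ℤ K n)
    {u v : Fin (n + 1) → V} (hu : Function.Injective u) (hv : Function.Injective v)
    (h : univ.map ⟨u, hu⟩ = univ.map ⟨v, hv⟩) (h0 : c v = 0) : c u = 0 := by
  obtain ⟨π, rfl⟩ := exists_perm_of_map_eq hu hv h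
  rw [hc.2, h0, smul_zero]

theorem map_cons_eq_insert [DecidableEq V] {w : V} {v : Fin n → V}
    (hi : Function.Injective (Fin.cons w v : Fin (n + 1) → V)) (hv : Function.Injective v) :
    univ.map ⟨(Fin.cons w v : Fin (n + 1) → V), hi⟩ = insert w (univ.map ⟨v, hv⟩) := by
  ext x
  simp [Fin.exists_fin_succ, eq_comm]

theorem exists_injective_map_eq {σ : Finset V} (h : σ.card = n) :
    ∃ (v : Fin n → V) (hv : Function.Injective v), univ.map ⟨v, hv⟩ = σ := by
  let e := (Fintype.equivFinOfCardEq (by simpa using h) : σ ≃ Fin n).symm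
  refine ⟨fun i => e i, Subtype.val_injective.comp e.injective, ?_⟩
  ext x
  constructor
  · simp only [mem_map, mem_univ, true_and, Function.Embedding.coeFn_mk]
    rintro ⟨i, rfl⟩
    exact (e i).2
  · intro hx
    simp only [mem_map, mem_univ, true_and, Function.Embedding.coeFn_mk]
    exact ⟨e.symm ⟨x, hx⟩, by simp⟩

variable [Fintype V]

theorem boundary_apply (m : ℕ) (c : (Fin (m + 1) → V) → ℤ) (v : Fin m → V) :
    boundary ℤ V m c v = ∑ w, c (Fin.cons w v) := rfl

theorem boundary_mem_chains {c : (Fin (n + 1 + 1) → V) → ℤ} (hc : c ∈ chains ℤ K (n + 1)) :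
    boundary ℤ V (n + 1) c ∈ chains ℤ K n := by
  classical
  refine ⟨fun v hv => ?_, fun π v => ?_⟩
  · rw [boundary_apply] at hv
    obtain ⟨w, -, hw⟩ := exists_ne_zero_of_sum_ne_zero hv
    obtain ⟨hi, hm⟩ := hc.1 _ hw
    have hvi : Function.Injective v := (Fin.cons_injective_iff.1 hi).2
    refine ⟨hvi, (K.isRelLowerSet_faces hm).2 ?_ (by simp)⟩
    rw [map_cons_eq_insert hi hvi]
    exact subset_insert _ _
  · simp only [boundary_apply, smul_sum]
    refine sum_congr rfl fun w _ => ?_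
    -- This permutation fixes `0` and acts as `π` on the remaining positions, so it has the sign of
    -- `π`.
    have h := hc.2 (Equiv.Perm.decomposeFin.symm (0, π)) (Fin.cons w v)
    rw [Equiv.Perm.decomposeFin.symm_sign] at h
    rw [if_pos rfl, one_mul] at h
    rw [← h]
    congr 1
    ext i
    refine Fin.cases ?_ (fun i => ?_) i <;> simp

/-- Exchanging the two leading vertices changes the sign of `c`, so the double sum equals its own
negative and vanishes in `ℤ`. -/
theorem boundary_boundary {c : (Fin (n + 1 + 1) → V) → ℤ} (hc : c ∈ chains ℤ K (n + 1)) :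
    boundary ℤ V n (boundary ℤ V (n + 1) c) = 0 := by
  ext v
  simp only [boundary_apply, Pi.zero_apply]
  have key : ∀ x y : V, c (Fin.cons x (Fin.cons y v)) = - c (Fin.cons y (Fin.cons x v)) := by
    intro x y
    have h := hc.2 (Equiv.swap 0 1) (Fin.cons y (Fin.cons x v))
    rw [Equiv.Perm.sign_swap (by simp)] at h
    have h2 : (Fin.cons y (Fin.cons x v) : Fin (n + 1 + 1) → V) ∘ (Equiv.swap 0 1 : Equiv.Perm _) =
        Fin.cons x (Fin.cons y v) := by
      ext i
      refine Fin.cases ?_ (fun i => ?_) i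
      · simp
      · refine Fin.cases ?_ (fun i => ?_) i
        · simp
        · have : (Equiv.swap (0 : Fin (n + 1 + 1)) 1) i.succ.succ = i.succ.succ :=
            Equiv.swap_apply_of_ne_of_ne (Fin.succ_ne_zero _)
              (fun h => Fin.succ_ne_zero i (Fin.succ_injective _ h))
          simp [this]
    rw [h2] at h
    simpa using h
  have h2 : ∑ w, ∑ u, c (Fin.cons u (Fin.cons w v)) =
      - ∑ w, ∑ u, c (Fin.cons u (Fin.cons w v)) := by
    conv_lhs => rw [sum_comm]
    rw [← sum_neg_distrib]
    refine sum_congr rfl fun u _ => ?_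
    rw [← sum_neg_distrib]
    exact sum_congr rfl fun w _ => key _ _
  omega

end Chains

/-! ### Single oriented simplices as chains. -/

section Simplex

variable {V : Type u} [DecidableEq V] {K : PreAbstractSimplicialComplex V} {n : ℕ}

/-- The oriented simplex `[v 0, …, v (n - 1)]` as a chain. -/
def simplex (v : Fin n → V) (u : Fin n → V) : ℤ :=
  ∑ π : Equiv.Perm (Fin n), if v ∘ π = u then (Equiv.Perm.sign π : ℤ) else 0

theorem simplex_self {v : Fin n → V} (hv : Function.Injective v) : simplex v v = 1 := by
  rw [simplex, sum_eq_single 1]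
  · simp
  · intro π _ hπ
    rw [if_neg]
    intro h
    apply hπ
    ext i
    exact congrArg _ (hv (congrFun h i))
  · simp

theorem exists_of_simplex_ne_zero {v u : Fin n → V} (h : simplex v u ≠ 0) :
    ∃ π : Equiv.Perm (Fin n), v ∘ π = u := by
  obtain ⟨π, -, hπ⟩ := exists_ne_zero_of_sum_ne_zero h
  exact ⟨π, by_contra fun h' => hπ (if_neg h')⟩

theorem map_eq_of_simplex_ne_zero {v u : Fin n → V} (hv : Function.Injective v)
    (h : simplex v u ≠ 0) :
    ∃ hu : Function.Injective u, univ.map ⟨u, hu⟩ = univ.map ⟨v, hv⟩ := by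
  obtain ⟨π, rfl⟩ := exists_of_simplex_ne_zero h
  refine ⟨hv.comp π.injective, ?_⟩
  ext x
  simp only [mem_map, mem_univ, true_and, Function.Embedding.coeFn_mk, Function.comp_apply]
  exact ⟨fun ⟨i, hi⟩ => ⟨π i, hi⟩, fun ⟨i, hi⟩ => ⟨π.symm i, by simpa using hi⟩⟩

theorem simplex_mem_chains {v : Fin (n + 1) → V} (hv : Function.Injective v)
    (hK : univ.map ⟨v, hv⟩ ∈ K) : simplex v ∈ chains ℤ K n := by
  refine ⟨fun u hu => ?_, fun ρ u => ?_⟩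
  · obtain ⟨hi, h⟩ := map_eq_of_simplex_ne_zero hv hu
    exact ⟨hi, h ▸ hK⟩
  · simp only [simplex, smul_sum]
    rw [← Equiv.sum_comp (Equiv.mulRight ρ)]
    refine sum_congr rfl fun π _ => ?_
    have h : v ∘ (Equiv.mulRight ρ π : Equiv.Perm _) = u ∘ ρ ↔ v ∘ π = u := by
      constructor
      · intro h
        ext i
        simpa using congrFun h (ρ.symm i)
      · rintro rfl
        rfl
    simp only [h]
    split_ifs
    · simp [mul_comm]
    · simp

/-- Only `w = x` contributes to the sum: any other `w` for which `(w, s)` reorders `(x, s)` would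
have to be an entry of `s`. This allows the coefficient of a chain on `s` to be cancelled by a
boundary. -/
theorem boundary_simplex_cons [Fintype V] {x : V} {s : Fin n → V}
    (h : Function.Injective (Fin.cons x s : Fin (n + 1) → V)) :
    boundary ℤ V n (simplex (Fin.cons x s : Fin (n + 1) → V)) s = 1 := by
  have hs : Function.Injective s := (Fin.cons_injective_iff.1 h).2
  rw [boundary_apply, sum_eq_single x, simplex_self h]
  · intro w _ hw
    by_contra h'
    obtain ⟨hi, hm⟩ := map_eq_of_simplex_ne_zero h h'
    rw [map_cons_eq_insert hi hs, map_cons_eq_insert h hs] at hm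
    have : w ∈ insert x (univ.map ⟨s, hs⟩) := hm ▸ mem_insert_self _ _
    rcases mem_insert.1 this with rfl | hw'
    · exact hw rfl
    · refine (Fin.cons_injective_iff.1 hi).1 ?_
      simpa using hw'
  · simp

end Simplex

/-! ### Acyclic complexes and elementary collapses. -/

section Acyclic

variable {V : Type u} [Fintype V] {K K₀ : PreAbstractSimplicialComplex V}

/-- `K` is nonempty and has vanishing reduced homology with integral coefficients. -/
structure IsAcyclic (K : PreAbstractSimplicialComplex V) : Prop where
  nonempty : ∃ p, {p} ∈ K
  exact : ∀ n, ∀ z ∈ chains ℤ K n, boundary ℤ V n z = 0 →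
    ∃ b ∈ chains ℤ K (n + 1), boundary ℤ V (n + 1) b = z

/-- In degree `0` the operator `boundary ℤ V 0` is the augmentation, which is injective on multiples
of a single vertex. In positive degrees there are no nonzero chains. -/
theorem isAcyclic_of_forall_mem_iff {p : V} (h : ∀ σ, σ ∈ K ↔ σ = {p}) : IsAcyclic K := by
  refine ⟨⟨p, (h _).2 rfl⟩, fun n z hz hb => ⟨0, zero_mem _, ?_⟩⟩
  have hp : ∀ v, z v ≠ 0 → v = fun _ => p := by
    intro v hv
    obtain ⟨hi, hm⟩ := hz.1 v hv
    ext i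
    have : v i ∈ univ.map ⟨v, hi⟩ := by simp
    rw [(h _).1 hm] at this
    simpa using this
  rw [map_zero]
  symm
  ext v
  by_contra hv
  obtain rfl := hp v hv
  obtain ⟨hi, -⟩ := hz.1 _ hv
  obtain rfl : n = 0 := by
    by_contra hn
    exact hn (by simpa using @hi 0 (Fin.last n) rfl)
  have h0 := congrFun hb (fun _ => p)
  rw [boundary_apply, sum_eq_single p] at h0
  · apply hv
    rw [show (Fin.cons p fun _ => p : Fin (0 + 1) → V) = fun _ => p by
      ext i
      rw [Fin.fin_one_eq_zero i]
      simp] at h0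
    exact h0
  · intro w _ hw
    by_contra h'
    exact hw (by simpa using congrFun (hp _ h') 0)
  · simp

/-- A cycle of `K` can be moved into `K₀` by subtracting a boundary. In degree `dim σ` a multiple of
the boundary of `insert x σ` cancels the coefficient on `σ`. In the next degree the coefficient on
`insert x σ` is already zero, because `σ` has no other coface that could cancel it in the boundary.
In all other degrees the cycle lies in `K₀` from the start. -/
theorem IsAcyclic.of_collapse [DecidableEq V] {σ : Finset V} {x : V} (h₀ : IsAcyclic K₀)
    (hK₀ : ∀ ρ, ρ ∈ K₀ ↔ ρ ∈ K ∧ ρ ≠ σ ∧ ρ ≠ insert x σ) (hσ : σ.Nonempty) (hx : x ∉ σ)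
    (hτ : insert x σ ∈ K) (hfree : ∀ y, y ∉ σ → insert y σ ∈ K → y = x) : IsAcyclic K := by
  have hle : ∀ ρ ∈ K₀, ρ ∈ K := fun ρ hρ => ((hK₀ ρ).1 hρ).1
  obtain ⟨p, hp⟩ := h₀.nonempty
  obtain ⟨k, hk⟩ : ∃ k, σ.card = k + 1 := ⟨σ.card - 1, by have := hσ.card_pos; omega⟩
  obtain ⟨s, hs, hsσ⟩ := exists_injective_map_eq hk
  have hcons : Function.Injective (Fin.cons x s : Fin (k + 1 + 1) → V) := by
    rw [Fin.cons_injective_iff]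
    refine ⟨fun h => hx ?_, hs⟩
    rw [← hsσ]
    simpa using h
  have hconsτ : univ.map ⟨_, hcons⟩ = insert x σ := by
    rw [map_cons_eq_insert hcons hs, hsσ]
  refine ⟨⟨p, hle _ hp⟩, fun n z hz hb => ?_⟩
  have lift : ∀ z' ∈ chains ℤ K₀ n, boundary ℤ V n z' = 0 →
      ∃ b ∈ chains ℤ K (n + 1), boundary ℤ V (n + 1) b = z' := fun z' hz' hb' => by
    obtain ⟨b, hb, h⟩ := h₀.exact n z' hz' hb'
    exact ⟨b, chains_mono hle hb, h⟩
  have hcases : ∀ ρ ∈ K, ρ ∉ K₀ → ρ = σ ∨ ρ = insert x σ := by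
    intro ρ h1 h2
    by_contra h3
    push Not at h3
    exact h2 ((hK₀ ρ).2 ⟨h1, h3⟩)
  by_cases h1 : n = k
  · subst h1
    have hE := simplex_mem_chains hcons (hconsτ ▸ hτ)
    obtain ⟨b, hbm, hbz⟩ := lift (z - z s • boundary ℤ V (n + 1) (simplex (Fin.cons x s)))
      (by
        have hz' := sub_mem hz ((chains ℤ K n).smul_mem (z s) (boundary_mem_chains hE))
        refine mem_chains_of_forall_eq_zero hz' fun v hv hm hm' => ?_
        rcases hcases _ hm hm' with h | h
        · refine eq_zero_of_map_eq hz' hv hs (h.trans hsσ.symm) ?_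
          simp [boundary_simplex_cons hcons]
        · have := congrArg card h
          rw [card_insert_of_notMem hx, hk] at this
          simp at this)
      (by rw [map_sub, map_smul, hb, boundary_boundary hE]; simp)
    refine ⟨b + z s • simplex (Fin.cons x s),
      add_mem hbm (Submodule.smul_mem _ _ hE), ?_⟩
    rw [map_add, hbz, map_smul]
    simp
  · apply lift z _ hb
    refine mem_chains_of_forall_eq_zero hz fun v hv hm hm' => ?_
    rcases hcases _ hm hm' with h | h
    · have := congrArg card h
      rw [hk] at this
      simp at this
      exact absurd this h1
    · obtain rfl : n = k + 1 := by
        have := congrArg card h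
        rw [card_insert_of_notMem hx, hk] at this
        simpa using this
      refine eq_zero_of_map_eq hz hv hcons (h.trans hconsτ.symm) ?_
      -- The coefficient of the boundary at `s` reduces to `z (x, s)`, since `x` is the only vertex
      -- that completes `σ` to a face.
      have h0 := congrFun hb s
      rw [boundary_apply, sum_eq_single x] at h0
      · exact h0
      · intro w _ hw
        by_contra h'
        obtain ⟨hi, hm⟩ := hz.1 _ h'
        rw [map_cons_eq_insert hi hs, hsσ] at hm
        refine hw (hfree w (fun hwσ => (Fin.cons_injective_iff.1 hi).1 ?_) hm)
        rw [← hsσ] at hwσ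
        simpa using hwσ
      · simp

end Acyclic

/-! ### From an acyclic complex to a sphere by adding one facet. -/

section Sphere

variable {V : Type u} [Fintype V] {K K₀ : PreAbstractSimplicialComplex V}

theorem nonempty_homology_equiv {n : ℕ} {M : Type*} [AddCommGroup M]
    (Φ : ((Fin (n + 1) → V) → ℤ) →ₗ[ℤ] M)
    (hsurj : ∀ m, ∃ z ∈ cycles ℤ K n, Φ z = m)
    (hb : ∀ b ∈ chains ℤ K (n + 1), Φ (boundary ℤ V (n + 1) b) = 0)
    (hker : ∀ z ∈ cycles ℤ K n, Φ z = 0 → z ∈ boundaries ℤ K n) :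
    Nonempty (Homology ℤ K n ≃ₗ[ℤ] M) := by
  let Ψ : cycles ℤ K n →ₗ[ℤ] M := Φ ∘ₗ (cycles ℤ K n).subtype
  have hΨ : Function.Surjective Ψ := fun m => by
    obtain ⟨z, hz, h⟩ := hsurj m
    exact ⟨⟨z, hz⟩, h⟩
  have hk : (boundaries ℤ K n).submoduleOf (cycles ℤ K n) = LinearMap.ker Ψ := by
    ext ⟨z, hz⟩
    rw [Submodule.submoduleOf, Submodule.mem_comap, LinearMap.mem_ker]
    constructor
    · rintro ⟨b, hb', h⟩
      change Φ z = 0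
      change _ = z at h
      rw [← h]
      exact hb b hb'
    · exact fun h => hker z hz h
  exact ⟨(Submodule.quotEquivOfEq _ _ hk).trans (Ψ.quotKerEquivOfSurjective hΨ)⟩

/-- The coefficient on `F` carries all the reduced homology. It vanishes on boundaries because `F`
is maximal, and a (reduced) cycle on which it vanishes lies in `K₀` and therefore bounds. In degree
`0` the augmentation is a further coordinate, as the homology is not reduced. -/
theorem hasHomologyOfSphere_of_isAcyclic_erase [DecidableEq V] {F : Finset V} {d : ℕ}
    (h₀ : IsAcyclic K₀) (hK₀ : ∀ ρ, ρ ∈ K₀ ↔ ρ ∈ K ∧ ρ ≠ F) (hF : F ∈ K) (hd : F.card = d + 1)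
    (hmax : ∀ y, y ∉ F → insert y F ∉ K) : HasHomologyOfSphere ℤ K d := by
  have hle : ∀ ρ ∈ K₀, ρ ∈ K := fun ρ hρ => ((hK₀ ρ).1 hρ).1
  obtain ⟨p, hp⟩ := h₀.nonempty
  obtain ⟨f, hf, hfF⟩ := exists_injective_map_eq hd
  have hE : simplex f ∈ chains ℤ K d := simplex_mem_chains hf (hfF ▸ hF)
  have hpi : Function.Injective (fun _ : Fin (0 + 1) => p) :=
    fun i j _ => (Fin.fin_one_eq_zero i).trans (Fin.fin_one_eq_zero j).symm
  have hpm : univ.map ⟨_, hpi⟩ = {p} := by ext; simp [eq_comm]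
  have hP : simplex (fun _ : Fin (0 + 1) => p) ∈ chains ℤ K 0 :=
    simplex_mem_chains hpi (hpm ▸ hle _ hp)
  let nil : Fin 0 → V := Fin.elim0
  have haug : ∀ v : Fin (0 + 1) → V, Function.Injective v →
      boundary ℤ V 0 (simplex v) nil = 1 := by
    intro v hv
    have : v = Fin.cons (v 0) nil := by ext i; rw [Fin.fin_one_eq_zero i]; simp
    rw [this] at hv ⊢
    exact boundary_simplex_cons hv
  have hbf : ∀ b ∈ chains ℤ K (d + 1), boundary ℤ V (d + 1) b f = 0 := by
    intro b hb
    rw [boundary_apply]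
    refine sum_eq_zero fun w _ => by_contra fun h => ?_
    obtain ⟨hi, hm⟩ := hb.1 _ h
    rw [map_cons_eq_insert hi hf, hfF] at hm
    refine hmax w (fun hw => (Fin.cons_injective_iff.1 hi).1 ?_) hm
    rw [← hfF] at hw
    simpa using hw
  -- The cast puts the condition on the coefficient at `F` only if `n = d`, so that all degrees are
  -- treated at once.
  have hbb : ∀ n, ∀ z ∈ chains ℤ K n, boundary ℤ V n z = 0 → 
      (∀ h : n = d, z (f ∘ Fin.cast (by rw [h])) = 0) → z ∈ boundaries ℤ K n := by
    intro n z hz hbz hzf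
    have hz₀ : z ∈ chains ℤ K₀ n := by
      refine mem_chains_of_forall_eq_zero hz fun v hv hm hm' => ?_
      have h : univ.map ⟨v, hv⟩ = F := by
        by_contra h
        exact hm' ((hK₀ _).2 ⟨hm, h⟩)
      obtain rfl : n = d := by
        have := congrArg card h
        rw [hd] at this
        simpa using this
      exact eq_zero_of_map_eq hz hv hf (h.trans hfF.symm) (hzf rfl)
    obtain ⟨b, hb, h⟩ := h₀.exact n z hz₀ hbz
    exact ⟨b, chains_mono hle hb, h⟩
  have ext_nil : ∀ g : (Fin 0 → V) → ℤ, g nil = 0 → g = 0 := by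
    intro g hg
    ext v
    rw [Subsingleton.elim v nil, hg]
    rfl
  intro n
  rcases Nat.eq_zero_or_pos n with rfl | hn
  · rcases Nat.eq_zero_or_pos d with rfl | hd0
    · rw [if_pos rfl]
      let Φ : ((Fin (0 + 1) → V) → ℤ) →ₗ[ℤ] (Fin (1 + 1) → ℤ) :=
        LinearMap.pi ![LinearMap.proj nil ∘ₗ boundary ℤ V 0, LinearMap.proj f]
      have hΦ : ∀ z, Φ z = ![boundary ℤ V 0 z nil, z f] := by
        intro z; ext i; fin_cases i <;> rfl
      have hPf : simplex (fun _ : Fin (0 + 1) => p) f = 0 := by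
        by_contra h
        obtain ⟨_, h⟩ := map_eq_of_simplex_ne_zero hpi h
        rw [hpm] at h
        exact ((hK₀ _).1 hp).2 (h.symm.trans hfF)
      refine nonempty_homology_equiv Φ (fun m => ?_) (fun b hb => ?_) (fun z hz h => ?_)
      -- The point `p` lies in `K₀`, so it is different from `F`: it has augmentation `1` and
      -- coefficient `0` on `F`.
      · refine ⟨(m 0 - m 1) • simplex (fun _ => p) + m 1 • simplex f,
          add_mem (Submodule.smul_mem _ _ hP) (Submodule.smul_mem _ _ hE), ?_⟩
        rw [hΦ]
        ext i
        fin_cases i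
        · simp only [map_add, map_smul, Pi.add_apply, Pi.smul_apply, haug _ hpi, haug _ hf]
          simp
        · simp [hPf, simplex_self hf]
      · rw [hΦ, boundary_boundary hb, hbf b hb]
        ext i
        fin_cases i <;> rfl
      · rw [hΦ] at h
        exact hbb 0 z hz (ext_nil _ (congrFun h 0)) (fun _ => congrFun h 1)
    · let Φ : ((Fin (0 + 1) → V) → ℤ) →ₗ[ℤ] (Fin (1 + 0) → ℤ) :=
        LinearMap.pi fun _ => LinearMap.proj nil ∘ₗ boundary ℤ V 0
      rw [if_pos rfl, if_neg hd0.ne]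
      refine nonempty_homology_equiv Φ (fun m => ?_) (fun b hb => ?_) (fun z hz h => ?_)
      · refine ⟨m 0 • simplex (fun _ => p), Submodule.smul_mem _ _ hP, ?_⟩
        ext i
        obtain rfl := Fin.fin_one_eq_zero i
        change boundary ℤ V 0 _ nil = _
        rw [map_smul]
        simp [haug _ hpi]
      · ext i
        change boundary ℤ V 0 _ nil = _
        rw [boundary_boundary hb]
        rfl
      · exact hbb 0 z hz (ext_nil _ (congrFun h 0)) (fun h => absurd h hd0.ne)
  · obtain ⟨k, rfl⟩ : ∃ k, n = k + 1 := ⟨n - 1, by omega⟩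
    rw [if_neg hn.ne']
    by_cases hnd : k + 1 = d
    · subst hnd
      rw [if_pos rfl]
      let Φ : ((Fin (k + 1 + 1) → V) → ℤ) →ₗ[ℤ] (Fin (0 + 1) → ℤ) :=
        LinearMap.pi fun _ => LinearMap.proj f
      refine nonempty_homology_equiv Φ (fun m => ?_) (fun b hb => ?_) (fun z hz h => ?_)
      -- The boundary of the facet lies in `K₀`, where it bounds some `b`. Then `simplex f - b` is a
      -- cycle with coefficient `1` on `F`.
      · have hE₀ : boundary ℤ V (k + 1) (simplex f) ∈ chains ℤ K₀ k := by
          refine mem_chains_of_forall_eq_zero (boundary_mem_chains hE) fun v hv hm hm' => ?_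
          have h : univ.map ⟨v, hv⟩ = F := by
            by_contra h
            exact hm' ((hK₀ _).2 ⟨hm, h⟩)
          have := congrArg card h
          rw [hd] at this
          simp at this
        obtain ⟨b, hb, hbE⟩ := h₀.exact k _ hE₀ (boundary_boundary hE)
        have hbf0 : b f = 0 := by
          by_contra h
          obtain ⟨_, hm⟩ := hb.1 _ h
          exact ((hK₀ _).1 hm).2 hfF
        refine ⟨m 0 • (simplex f - b), Submodule.smul_mem _ _
          ⟨sub_mem hE (chains_mono hle hb), ?_⟩, ?_⟩
        · simp [LinearMap.mem_ker, map_sub, hbE]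
        · ext i
          obtain rfl := Fin.fin_one_eq_zero i
          change (m 0 • (simplex f - b)) f = _
          simp [simplex_self hf, hbf0]
      · ext i
        exact hbf b hb
      · exact hbb _ z hz.1 hz.2 (fun _ => congrFun h 0)
    · rw [if_neg hnd]
      refine nonempty_homology_equiv 0 (fun m => ⟨0, zero_mem _, funext fun i => Fin.elim0 i⟩)
        (fun b hb => rfl) (fun z hz h => ?_)
      exact hbb _ z hz.1 hz.2 (fun h => absurd h hnd)

end Sphere

/-! ### Consequences of having the homology of a sphere. -/

section Necessary

variable {V : Type u} {X : PreAbstractSimplicialComplex V}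

/-- Without edges there are no boundaries in degree `0`, so `H_0` is free on the vertices; comparing
ranks gives two of them. -/
theorem ncard_vertices_of_hasHomologyOfSphere_zero [Fintype V] (h : HasHomologyOfSphere ℤ X 0)
    (hX : ∀ σ ∈ X, σ.card ≤ 1) : {v : V | {v} ∈ X}.ncard = 2 := by
  classical
  obtain ⟨e⟩ := h 0
  have hch : ∀ b ∈ chains ℤ X (0 + 1), b = 0 := by
    intro b hb
    ext v
    by_contra hv
    obtain ⟨hi, hm⟩ := hb.1 v hv
    have := hX _ hm
    simp at this
  have hmap : ∀ (v : Fin (0 + 1) → V) (hv : Function.Injective v),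
      univ.map ⟨v, hv⟩ = {v 0} := by
    intro v hv
    ext x
    simp
  let Φ : ((Fin (0 + 1) → V) → ℤ) →ₗ[ℤ] ({v : V | {v} ∈ X} → ℤ) :=
    LinearMap.pi fun v => LinearMap.proj fun _ => v.1
  obtain ⟨e'⟩ := nonempty_homology_equiv (K := X) Φ
    (fun m => by
      refine ⟨fun u => if hu : {u 0} ∈ X then m ⟨u 0, hu⟩ else 0,
        ⟨fun v hv => ?_, fun π v => ?_⟩, ?_⟩
      · have hi : Function.Injective v :=
          fun i j _ => (Fin.fin_one_eq_zero i).trans (Fin.fin_one_eq_zero j).symm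
        refine ⟨hi, ?_⟩
        rw [hmap]
        by_contra h'
        exact hv (dif_neg h')
      · have hπ : π = 1 := Equiv.ext fun i =>
          (Fin.fin_one_eq_zero _).trans (Fin.fin_one_eq_zero _).symm
        simp [hπ]
      · ext ⟨v, hv⟩
        exact dif_pos hv)
    (fun b hb => by rw [hch b hb, map_zero, map_zero])
    (fun z hz h0 => by
      refine ⟨0, zero_mem _, ?_⟩
      rw [map_zero]
      symm
      ext v
      by_contra hv
      obtain ⟨hi, hm⟩ := hz.1 v hv
      rw [hmap] at hm
      apply hv
      have := congrFun h0 ⟨v 0, hm⟩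
      rw [show v = fun _ => v 0 by ext i; rw [Fin.fin_one_eq_zero i]]
      exact this)
  have h2 := (e'.symm.trans e).finrank_eq
  rw [Module.finrank_fintype_fun_eq_card, Module.finrank_fintype_fun_eq_card] at h2
  rw [Set.ncard_eq_toFinset_card', Set.toFinset_card, h2]
  simp

variable [DecidableEq V]

/-- The difference of the two orderings of an edge, an oriented edge as a chain. -/
def edge (p q : V) (u : Fin (1 + 1) → V) : ℤ :=
  (if u 0 = p ∧ u 1 = q then 1 else 0) - (if u 0 = q ∧ u 1 = p then 1 else 0)

/-- A vertex as a chain. -/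
def point (p : V) (u : Fin (0 + 1) → V) : ℤ := if u 0 = p then 1 else 0

theorem edge_mem_chains {p q : V} (hpq : p ≠ q) (h : {p, q} ∈ X) : edge p q ∈ chains ℤ X 1 := by
  refine ⟨fun v hv => ?_, fun π v => ?_⟩
  · have h' : v 0 = p ∧ v 1 = q ∨ v 0 = q ∧ v 1 = p := by
      by_contra h'
      push Not at h'
      apply hv
      rw [edge, if_neg (by tauto), if_neg (by tauto), sub_zero]
    have hne : v 0 ≠ v 1 := by
      rcases h' with ⟨h1, h2⟩ | ⟨h1, h2⟩ <;> rw [h1, h2]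
      exacts [hpq, hpq.symm]
    have hi : Function.Injective v := by
      intro i j hij
      fin_cases i <;> fin_cases j <;> first | rfl | exact absurd hij hne | exact absurd hij hne.symm
    refine ⟨hi, ?_⟩
    rw [show univ.map ⟨v, hi⟩ = {p, q} from ?_]
    · exact h
    · ext x
      rcases h' with ⟨h1, h2⟩ | ⟨h1, h2⟩ <;>
        simp [Fin.exists_fin_two, h1, h2, eq_comm, or_comm]
  · have hπ : ∀ π : Equiv.Perm (Fin 2), π = 1 ∨ π = Equiv.swap 0 1 := by decide
    rcases hπ π with rfl | rfl
    · simp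
    · rw [Equiv.Perm.sign_swap (by decide)]
      simp only [edge, Function.comp_apply, Equiv.swap_apply_left, Equiv.swap_apply_right,
        and_comm (a := v 1 = _)]
      simp

variable [Fintype V]

theorem boundary_edge (p q : V) : boundary ℤ V 1 (edge p q) = point q - point p := by
  ext v
  rw [boundary_apply]
  have h1 : ∀ w : V, (Fin.cons w v : Fin (1 + 1) → V) 1 = v 0 := fun _ => rfl
  simp only [edge, Fin.cons_zero, h1, sum_sub_distrib, ite_and, sum_ite_eq', mem_univ, if_true,
    Pi.sub_apply, point]

/-- Discrete Stokes theorem. The pairing of `b` with the coboundary of `c` is zero. By the cyclic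
symmetry of `b` its three terms have equal sums, each of which is the pairing of the boundary of `b`
with `c`; hence three times that pairing vanishes. -/
theorem sum_cocycle_boundary {c : V → V → ℤ}
    (hc : ∀ x y z, {x, y, z} ∈ X → c x y + c y z + c z x = 0) {b : (Fin (2 + 1) → V) → ℤ}
    (hb : b ∈ chains ℤ X 2) :
    ∑ x, ∑ y, boundary ℤ V 2 b ![x, y] * c x y = 0 := by
  have hrot : ∀ g : V → V → V → ℤ,
      ∑ x, ∑ y, ∑ w, g w x y = ∑ x, ∑ y, ∑ w, g x y w := by
    intro g
    calc ∑ x, ∑ y, ∑ w, g w x y = ∑ x, ∑ w, ∑ y, g w x y :=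
          sum_congr rfl fun x _ => sum_comm
      _ = _ := sum_comm
  have hcons : ∀ w x y : V, (Fin.cons w ![x, y] : Fin (2 + 1) → V) = ![w, x, y] := fun _ _ _ => rfl
  have hb' : ∀ w x y, b ![x, y, w] = b ![w, x, y] := by
    intro w x y
    have := hb.2 (finRotate 3) ![w, x, y]
    rw [sign_finRotate] at this
    rw [show ![w, x, y] ∘ (finRotate 3 : Equiv.Perm _) = ![x, y, w] by
      ext i; fin_cases i <;> rfl] at this
    simpa using this
  have h0 : ∑ x, ∑ y, ∑ w, b ![w, x, y] * (c w x + c x y + c y w) = 0 := by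
    refine sum_eq_zero fun x _ => sum_eq_zero fun y _ => sum_eq_zero fun w _ => ?_
    by_cases h : b ![w, x, y] = 0
    · rw [h, zero_mul]
    · obtain ⟨hi, hm⟩ := hb.1 _ h
      rw [hc, mul_zero]
      convert hm using 1
      ext v
      simp [Fin.exists_fin_succ, eq_comm]
  have e1 : ∑ x, ∑ y, ∑ w, b ![w, x, y] * c x y = ∑ x, ∑ y, ∑ w, b ![w, x, y] * c y w := by
    rw [hrot (fun w x y => b ![w, x, y] * c x y)]
    simp only [hb']
  have e2 : ∑ x, ∑ y, ∑ w, b ![w, x, y] * c y w = ∑ x, ∑ y, ∑ w, b ![w, x, y] * c w x := by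
    rw [hrot (fun w x y => b ![w, x, y] * c y w)]
    simp only [hb']
  simp only [mul_add, sum_add_distrib] at h0
  simp only [boundary_apply, hcons, sum_mul]
  omega

/-- The closed path is a 1-cycle. As `m ≥ 2`, `H_1` vanishes, so the path bounds and
`sum_cocycle_boundary` applies. -/
theorem period_eq_zero_of_hasHomologyOfSphere {m : ℕ} (hm : 2 ≤ m)
    (h : HasHomologyOfSphere ℤ X m) {c : V → V → ℤ} (hanti : ∀ x y, c x y = - c y x)
    (hc : ∀ x y z, {x, y, z} ∈ X → c x y + c y z + c z x = 0) {x y z : V} (hxy : x ≠ y)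
    (hyz : y ≠ z) (hzx : z ≠ x) (hxyX : {x, y} ∈ X) (hyzX : {y, z} ∈ X) (hzxX : {z, x} ∈ X) :
    c x y + c y z + c z x = 0 := by
  have hz : edge x y + edge y z + edge z x ∈ chains ℤ X 1 := add_mem (add_mem
    (edge_mem_chains hxy hxyX) (edge_mem_chains hyz hyzX)) (edge_mem_chains hzx hzxX)
  have hb : boundary ℤ V 1 (edge x y + edge y z + edge z x) = 0 := by
    rw [map_add, map_add, boundary_edge, boundary_edge, boundary_edge]
    abel
  obtain ⟨e⟩ := h 1
  rw [if_neg one_ne_zero, if_neg (by omega)] at e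
  have h0 : (Submodule.Quotient.mk ⟨_, hz, hb⟩ : Homology ℤ X 1) = 0 :=
    e.injective (funext fun i => i.elim0)
  rw [Submodule.Quotient.mk_eq_zero] at h0
  obtain ⟨b, hb', hbz⟩ : edge x y + edge y z + edge z x ∈ boundaries ℤ X 1 := h0
  have h1 := sum_cocycle_boundary hc hb'
  -- Both orderings of an edge are summed, so by antisymmetry the result is twice the period.
  have h2 : ∀ p q, ∑ x, ∑ y, edge p q ![x, y] * c x y = c p q - c q p := by
    intro p q
    simp [edge, sub_mul, sum_sub_distrib, ite_and]
  rw [hbz] at h1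
  simp only [Pi.add_apply, add_mul, sum_add_distrib, h2] at h1
  rw [hanti y x, hanti z y, hanti x z] at h1
  omega

end Necessary

/-! ### The combinatorial conditions used in the classification. -/

section SphereLike

variable {V : Type u} [DecidableEq V]

/-- Combinatorial consequences of being a homology `3`-sphere: purity, every triangle lies in
exactly two tetrahedra, and integral `1`-cocycles of `K` and of the vertex links have trivial periods
along closed paths of length three. -/
structure IsSphereLike (K : PreAbstractSimplicialComplex V) : Prop where
  pure : ∀ σ ∈ K, ∃ τ ∈ K, σ ⊆ τ ∧ τ.card = 4
  triangle : ∀ σ ∈ K, σ.card = 3 → {v | v ∉ σ ∧ insert v σ ∈ K}.ncard = 2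
  period : ∀ σ : Finset V, σ.card ≤ 1 → (σ = ∅ ∨ σ ∈ K) → ∀ c : V → V → ℤ,
    (∀ x y, c x y = - c y x) →
    (∀ x y z, Disjoint {x, y, z} σ → {x, y, z} ∪ σ ∈ K → c x y + c y z + c z x = 0) →
    ∀ x y z, x ≠ y → y ≠ z → z ≠ x → Disjoint {x, y, z} σ → {x, y} ∪ σ ∈ K → {y, z} ∪ σ ∈ K →
      {z, x} ∪ σ ∈ K → c x y + c y z + c z x = 0

theorem IsHomologySphere.isSphereLike [Fintype V] {K : PreAbstractSimplicialComplex V}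
    (hK : IsHomologySphere ℤ K 3) : IsSphereLike K := by
  refine ⟨hK.1.pure, fun σ hσ hcard => ?_,
    fun σ hcard hσ c hanti hc x y z hxy hyz hzx hd h1 h2 h3 => ?_⟩
  · have h := ncard_vertices_of_hasHomologyOfSphere_zero (X := link K σ)
      -- By purity `τ ∪ σ` lies in a tetrahedron, so the link of a triangle has no edges.
      (by simpa [hcard] using hK.1.link σ hσ hcard.le) (by
        rintro τ ⟨-, hd, hm⟩
        obtain ⟨ρ, -, hle, hρ⟩ := hK.1.pure _ hm
        have := card_le_card hle
        rw [card_union_of_disjoint hd] at this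
        omega)
    convert h using 2
    ext v
    change _ ↔ ({v} : Finset V).Nonempty ∧ Disjoint {v} σ ∧ {v} ∪ σ ∈ K
    simp only [Set.mem_ofPred_eq, singleton_nonempty, disjoint_singleton_left, true_and]
    rw [insert_eq]
  · have hlink : HasHomologyOfSphere ℤ (link K σ) (3 - σ.card) := by
      rcases hσ with rfl | hσ
      · have : link K ∅ = K := by
          ext τ
          change τ.Nonempty ∧ Disjoint τ ∅ ∧ τ ∪ ∅ ∈ K ↔ τ ∈ K
          simp only [disjoint_empty_right, union_empty, true_and, and_iff_right_iff_imp]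
          exact fun h => (K.isRelLowerSet_faces h).1
        rw [this]
        exact hK.2
      · exact hK.1.link σ hσ (by omega)
    have hd' : ∀ τ ⊆ {x, y, z}, Disjoint τ σ := fun τ hτ => hd.mono_left hτ
    exact period_eq_zero_of_hasHomologyOfSphere (by omega) hlink hanti
      (fun x y z h => hc x y z h.2.1 h.2.2) hxy hyz hzx
      ⟨by simp, hd' _ (by simp [subset_iff]), h1⟩ ⟨by simp, hd' _ (by simp [subset_iff]), h2⟩
      ⟨by simp, hd' _ (by simp [subset_iff]), h3⟩

end SphereLike

end SimplicialHomology

/-! ### Vertex sets as bit masks. -/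

namespace EquivariantComplex

open SimplicialHomology

/-- The characteristic bit mask of a set of vertices. -/
def mask (σ : Finset W) : ℕ := Nat.ofBits fun i : Fin 10 => decide (i ∈ σ)

/-- The set of vertices with a given bit mask. -/
def unmask (s : ℕ) : Finset W := Finset.univ.filter fun i => s.testBit i

theorem testBit_mask (σ : Finset W) (i : W) : (mask σ).testBit i = decide (i ∈ σ) := by
  rw [mask, Nat.testBit_ofBits_lt _ _ i.isLt]

theorem testBit_mask_of_le (σ : Finset W) {i : ℕ} (hi : 10 ≤ i) : (mask σ).testBit i = false :=
  Nat.testBit_ofBits_ge _ _ hi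

theorem mask_lt (σ : Finset W) : mask σ < 1024 := Nat.ofBits_lt_two_pow _

theorem mem_unmask {s : ℕ} {i : W} : i ∈ unmask s ↔ s.testBit i := by
  simp [unmask]

theorem unmask_mask (σ : Finset W) : unmask (mask σ) = σ := by
  ext i
  simp [mem_unmask, testBit_mask]

theorem mask_injective : Function.Injective mask :=
  Function.LeftInverse.injective unmask_mask

theorem mask_eq_of_testBit {σ : Finset W} {s : ℕ} (hs : s < 1024)
    (h : ∀ i : W, i ∈ σ ↔ s.testBit i) : mask σ = s := by
  refine Nat.eq_of_testBit_eq fun i => ?_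
  by_cases hi : i < 10
  · rw [Bool.eq_iff_iff, ← h ⟨i, hi⟩]
    simpa using Bool.eq_iff_iff.1 (testBit_mask σ ⟨i, hi⟩)
  · rw [testBit_mask_of_le σ (not_lt.1 hi), Nat.testBit_lt_two_pow]
    exact hs.trans_le (Nat.pow_le_pow_right two_pos (not_lt.1 hi))

theorem mask_unmask {s : ℕ} (hs : s < 1024) : mask (unmask s) = s :=
  mask_eq_of_testBit hs fun _ => mem_unmask

theorem mask_empty : mask ∅ = 0 := mask_eq_of_testBit (by norm_num) (by simp)

theorem mask_eq_zero {σ : Finset W} : mask σ = 0 ↔ σ = ∅ := by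
  rw [← mask_empty, mask_injective.eq_iff]

theorem testBit_one_shiftLeft (n m : ℕ) : (1 <<< n).testBit m = decide (m = n) := by
  rw [Nat.one_shiftLeft, Nat.testBit_two_pow, Bool.eq_iff_iff, decide_eq_true_iff,
    decide_eq_true_iff, eq_comm]

theorem mask_insert (x : W) (σ : Finset W) : mask (insert x σ) = mask σ ||| 1 <<< x.val := by
  refine mask_eq_of_testBit ?_ fun i => ?_
  · refine Nat.or_lt_two_pow (n := 10) (mask_lt σ) ?_
    rw [Nat.one_shiftLeft]
    exact Nat.pow_lt_pow_right (by norm_num) x.isLt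
  · rw [Nat.testBit_or, testBit_mask, testBit_one_shiftLeft]
    simp [Fin.ext_iff, or_comm]

theorem land_mask_eq_right {σ τ : Finset W} : mask τ &&& mask σ = mask σ ↔ σ ⊆ τ := by
  constructor
  · intro h i hi
    have := congrArg (fun s => s.testBit i) h
    simpa [testBit_mask, hi] using this
  · intro h
    refine (mask_eq_of_testBit ((Nat.and_le_left).trans_lt (mask_lt τ)) fun i => ?_).symm
    rw [Nat.testBit_and, testBit_mask, testBit_mask]
    simpa using @h i

theorem mask_union (σ τ : Finset W) : mask (σ ∪ τ) = mask σ ||| mask τ := by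
  refine mask_eq_of_testBit (Nat.or_lt_two_pow (n := 10) (mask_lt σ) (mask_lt τ)) fun i => ?_
  rw [Nat.testBit_or, testBit_mask, testBit_mask]
  simp

theorem mask_singleton (x : W) : mask {x} = 1 <<< x.val := by
  rw [← insert_empty_eq, mask_insert, mask_empty, Nat.zero_or]

theorem mask_lt_iff_exists {s : ℕ} : s < 1024 ↔ ∃ σ, mask σ = s :=
  ⟨fun h => ⟨_, mask_unmask h⟩, by rintro ⟨σ, rfl⟩; exact mask_lt σ⟩

/-! ### A computable test for spheres by greedy collapses. -/

section Kernel

/-! The functions in this section are evaluated by the kernel. They are written in terms of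
recursors, and they pass on evaluated arguments, in order to make this fast. -/

/-- The binary digit of `N` at `s`. -/
def bit (N s : ℕ) : Bool := Nat.beq (Nat.land (Nat.shiftRight N s) 1) 1

theorem bit_eq_testBit (N s : ℕ) : bit N s = N.testBit s := by
  rw [Bool.eq_iff_iff, bit, Nat.testBit, Nat.beq_eq]
  change (N >>> s) &&& 1 = 1 ↔ _
  rw [Nat.and_comm 1, Nat.and_one_is_mod]
  simp

/-- Apply `k` to the value of `n`. -/
noncomputable def force (n : ℕ) (k : ℕ → Bool) : Bool := Nat.rec (k 0) (fun m _ => k (Nat.succ m)) n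

theorem force_eq (n : ℕ) (k : ℕ → Bool) : force n k = k n := by
  cases n <;> rfl

/-- Whether some entry of `l` satisfies `p`. -/
noncomputable def anyOf {α : Type*} (p : α → Bool) (l : List α) : Bool :=
  List.rec false (fun x _ ih => bif p x then true else ih) l

theorem anyOf_eq_true {α : Type*} {p : α → Bool} {l : List α} :
    anyOf p l = true ↔ ∃ x ∈ l, p x = true := by
  induction l with
  | nil => simp [anyOf]
  | cons x l ih =>
    change (bif p x then true else anyOf p l) = true ↔ _
    cases h : p x <;> simp [h, ih]

/-- Whether all entries of `l` satisfy `p`. -/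
noncomputable def allOf {α : Type*} (p : α → Bool) (l : List α) : Bool :=
  List.rec true (fun x _ ih => bif p x then ih else false) l

theorem allOf_eq_true {α : Type*} {p : α → Bool} {l : List α} :
    allOf p l = true ↔ ∀ x ∈ l, p x = true := by
  induction l with
  | nil => simp [allOf]
  | cons x l ih =>
    change (bif p x then allOf p l else false) = true ↔ _
    cases h : p x <;> simp [h, ih]

/-- Apply `k` to the left fold of `f`. -/
noncomputable def foldThen (f : ℕ → ℕ → ℕ) (k : ℕ → Bool) (l : List ℕ) : ℕ → Bool :=
  List.rec k (fun s _ ih N => force (f N s) ih) l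

theorem foldThen_eq (f : ℕ → ℕ → ℕ) (k : ℕ → Bool) (l : List ℕ) (N : ℕ) :
    foldThen f k l N = k (l.foldl f N) := by
  induction l generalizing N with
  | nil => rfl
  | cons s l ih =>
    change force (f N s) (foldThen f k l) = _
    rw [force_eq, ih, List.foldl_cons]

theorem testBit_foldl_lor (l : List ℕ) (a s : ℕ) :
    (l.foldl (fun N s => Nat.lor N (Nat.shiftLeft 1 s)) a).testBit s ↔ a.testBit s ∨ s ∈ l := by
  induction l generalizing a with
  | nil => simp
  | cons x l ih =>
    rw [List.foldl_cons, ih]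
    change (a ||| 1 <<< x).testBit s = true ∨ _ ↔ _
    rw [Nat.testBit_or, testBit_one_shiftLeft]
    simp [or_assoc]

/-- Apply `k` to the reversed list. -/
noncomputable def reverseThen (k : List ℕ → Bool) (l : List ℕ) : List ℕ → Bool :=
  List.rec k (fun s _ ih acc => force s fun s => ih (s :: acc)) l

theorem reverseThen_eq (k : List ℕ → Bool) (l acc : List ℕ) :
    reverseThen k l acc = k (l.reverse ++ acc) := by
  induction l generalizing acc with
  | nil => rfl
  | cons s l ih =>
    change force s (fun s => reverseThen k l (s :: acc)) = _
    rw [force_eq, ih]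
    simp

/-- The vertices in `Fin 10` as natural numbers. -/
def vertices : List ℕ := [0, 1, 2, 3, 4, 5, 6, 7, 8, 9]

theorem mem_vertices {v : ℕ} : v ∈ vertices ↔ v < 10 := by
  constructor
  · revert v
    decide
  · intro h
    interval_cases v <;> decide

/-- The number of vertices in a bit mask. -/
noncomputable def size (s : ℕ) : ℕ :=
  List.rec 0 (fun v _ ih => Nat.add (Nat.land (Nat.shiftRight s v) 1) ih) vertices

theorem size_mask (σ : Finset W) : size (mask σ) = σ.card := by
  have h : ∀ v : W, Nat.land (Nat.shiftRight (mask σ) v) 1 = if v ∈ σ then 1 else 0 := by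
    intro v
    change (mask σ >>> v.val) &&& 1 = _
    have := testBit_mask σ v
    rw [Nat.testBit, Nat.and_comm 1, Nat.and_one_is_mod] at this
    rw [Nat.and_one_is_mod]
    split_ifs with hv
    · simpa [hv] using this
    · simpa [hv] using this
  have h2 : σ.card = ∑ v : W, if v ∈ σ then 1 else 0 := by simp
  rw [h2, Fin.sum_univ_def]
  simp only [← h]
  rfl

/-- The vertices whose addition to the face `s` gives a face of the complex with bit set `N`. -/
noncomputable def cofaceVertices (N s : ℕ) : List ℕ :=
  List.rec [] (fun v _ ih =>
    bif Bool.or (bit s v) (Bool.not (bit N (Nat.lor s (Nat.shiftLeft 1 v))))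
    then ih else v :: ih) vertices

theorem mem_cofaceVertices {N s v : ℕ} :
    v ∈ cofaceVertices N s ↔ v < 10 ∧ s.testBit v = false ∧ N.testBit (s ||| 1 <<< v) := by
  have : cofaceVertices N s =
      vertices.filter fun v => !(s.testBit v || !(N.testBit (s ||| 1 <<< v))) := by
    rw [cofaceVertices]
    generalize vertices = l
    induction l with
    | nil => rfl
    | cons x l ih =>
      rw [List.filter_cons, ← ih]
      simp only [bit_eq_testBit]
      change (bif (s.testBit x || !(N.testBit (s ||| 1 <<< x))) then _ else _) = _
      cases (s.testBit x || !(N.testBit (s ||| 1 <<< x))) <;> rfl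
  rw [this, List.mem_filter, mem_vertices]
  simp

/-- The value of `f` at the only entry of `l`, or `a` if there is not exactly one. -/
noncomputable def onlyEntry (l : List ℕ) (a : ℕ) (f : ℕ → ℕ) : ℕ :=
  List.rec a (fun x t _ => List.rec (f x) (fun _ _ _ => a) t) l

/-- Remove `s` and its coface if `s` is a free face. -/
noncomputable def collapseStep (N s : ℕ) : ℕ :=
  bif bit N s then
    onlyEntry (cofaceVertices N s) N fun v =>
      Nat.xor (Nat.xor N (Nat.shiftLeft 1 s)) (Nat.shiftLeft 1 (Nat.lor s (Nat.shiftLeft 1 v)))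
  else N

/-- Whether the complex with bit set `N` is a single vertex. -/
noncomputable def isVertex (N : ℕ) : Bool :=
  anyOf (fun p => Nat.beq N (Nat.shiftLeft 1 (Nat.shiftLeft 1 p))) vertices

/-- Check that at most `k` rounds of greedy collapses along `l` lead to a vertex. -/
noncomputable def isCollapsible (l : List ℕ) (k : ℕ) : ℕ → Bool :=
  Nat.rec (fun _ => false)
    (fun _ ih N => bif isVertex N then true else foldThen collapseStep ih l N) k

/-- Check that the complex with list of faces `l` becomes collapsible after removal of some
facet of dimension `d`. -/
noncomputable def isSphere (l : List ℕ) (d : ℕ) : Bool :=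
  foldThen (fun N s => Nat.lor N (Nat.shiftLeft 1 s)) (fun N =>
    anyOf (fun s => bif Nat.beq (size s) (Nat.add d 1) then
      Bool.and (cofaceVertices N s).isEmpty
        (force (Nat.xor N (Nat.shiftLeft 1 s)) (isCollapsible l 30)) else false) l) l 0

/-- The list of faces of the link of `s`. -/
noncomputable def linkFaces (s : ℕ) (l : List ℕ) : List ℕ :=
  List.rec [] (fun t _ ih => bif Nat.beq (Nat.land t s) s then
    (bif Nat.beq t s then ih else Nat.xor t s :: ih) else ih) l

theorem mem_linkFaces {s t : ℕ} {l : List ℕ} :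
    t ∈ linkFaces s l ↔ ∃ u ∈ l, u &&& s = s ∧ u ≠ s ∧ u ^^^ s = t := by
  induction l with
  | nil => simp [linkFaces]
  | cons u l ih =>
    change t ∈ (bif Nat.beq (u &&& s) s then (bif Nat.beq u s then linkFaces s l else
      (u ^^^ s) :: linkFaces s l) else linkFaces s l) ↔ _
    cases h : Nat.beq (u &&& s) s
    · have h' := Nat.ne_of_beq_eq_false h
      simp [h', ih]
    · have h' := Nat.eq_of_beq_eq_true h
      cases h2 : Nat.beq u s
      · have h2' := Nat.ne_of_beq_eq_false h2
        simp [h', h2', ih, eq_comm (a := t)]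
      · have h2' := Nat.eq_of_beq_eq_true h2
        simp [h2', ih]

/-- Apply `k` to the list of nonempty faces (among `1, …, n`) of the complex with facets `fs`. -/
noncomputable def facesThen (k : List ℕ → Bool) (fs : List ℕ) (n : ℕ) : List ℕ → Bool :=
  Nat.rec k (fun s ih acc =>
    bif anyOf (fun f => Nat.beq (Nat.land f (Nat.succ s)) (Nat.succ s)) fs then
      ih (Nat.succ s :: acc) else ih acc) n

theorem facesThen_eq (k : List ℕ → Bool) (fs : List ℕ) (n : ℕ) (acc : List ℕ) :
    ∃ l, facesThen k fs n acc = k l ∧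
      ∀ s, s ∈ l ↔ s ∈ acc ∨ (0 < s ∧ s ≤ n ∧ ∃ f ∈ fs, f &&& s = s) := by
  induction n generalizing acc with
  | zero => exact ⟨acc, rfl, fun s => by simp; omega⟩
  | succ n ih =>
    have hstep : facesThen k fs (n + 1) acc =
        bif anyOf (fun f => Nat.beq (f &&& (n + 1)) (n + 1)) fs then
          facesThen k fs n ((n + 1) :: acc) else facesThen k fs n acc := rfl
    rw [hstep]
    cases h : anyOf (fun f => Nat.beq (f &&& (n + 1)) (n + 1)) fs
    · obtain ⟨l, h1, h2⟩ := ih acc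
      refine ⟨l, h1, fun s => ?_⟩
      rw [h2]
      refine or_congr_right ⟨fun ⟨h3, h4, h5⟩ => ⟨h3, by omega, h5⟩, fun ⟨h3, h4, h5⟩ =>
        ⟨h3, ?_, h5⟩⟩
      by_contra h6
      obtain rfl : s = n + 1 := by omega
      rw [← Bool.not_eq_true, anyOf_eq_true] at h
      obtain ⟨f, hf, hfs⟩ := h5
      exact h ⟨f, hf, by rw [hfs]; exact Nat.beq_refl _⟩
    · obtain ⟨l, h1, h2⟩ := ih ((n + 1) :: acc)
      refine ⟨l, h1, fun s => ?_⟩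
      rw [anyOf_eq_true] at h
      obtain ⟨f, hf, hfs⟩ := h
      have hfs' := Nat.eq_of_beq_eq_true hfs
      rw [h2, List.mem_cons]
      constructor
      · rintro ((rfl | h) | ⟨h3, h4, h5⟩)
        · exact Or.inr ⟨by omega, le_rfl, f, hf, hfs'⟩
        · exact Or.inl h
        · exact Or.inr ⟨h3, by omega, h5⟩
      · rintro (h | ⟨h3, h4, h5⟩)
        · exact Or.inl (Or.inr h)
        · by_cases h6 : s = n + 1
          · exact Or.inl (Or.inl h6)
          · exact Or.inr ⟨h3, by omega, h5⟩

/-- Check that the complex with facets `fs` is a `3`-sphere all of whose links are spheres. -/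
noncomputable def isSphereManifold (fs : List ℕ) : Bool :=
  facesThen (fun l => Bool.and (isSphere l 3) (allOf (fun s => bif Nat.ble (size s) 3 then
    reverseThen (fun l => isSphere l (Nat.sub 3 (size s))) (linkFaces s l) [] else true) l))
    fs 1023 []

end Kernel

/-! ### Correctness of the test. -/

section Soundness

variable {K : PreAbstractSimplicialComplex W}

/-- The faces of `K` are the positions of the binary digits `1` of `N`. -/
def Encodes (K : PreAbstractSimplicialComplex W) (N : ℕ) : Prop :=
  ∀ σ, σ ∈ K ↔ σ.Nonempty ∧ N.testBit (mask σ)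

/-- If exactly one vertex extends `s` to a face, then `s` is a free face and the step is an
elementary collapse; both digits are `1`, so `xor` deletes them. Otherwise nothing changes. The mask
`0` is excluded because the empty set is not a face. -/
theorem exists_encodes_collapseStep {N s : ℕ} (hs : s < 1024) (hs0 : 0 < s) (hK : Encodes K N) :
    ∃ K₀, Encodes K₀ (collapseStep N s) ∧ (IsAcyclic K₀ → IsAcyclic K) := by
  rw [collapseStep, bit_eq_testBit]
  cases hN : N.testBit s
  · exact ⟨K, hK, id⟩
  rw [cond_true]
  rcases hl : cofaceVertices N s with _ | ⟨v, _ | ⟨w, l⟩⟩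
  · exact ⟨K, hK, id⟩
  swap
  · exact ⟨K, hK, id⟩
  obtain ⟨σ, rfl⟩ := mask_lt_iff_exists.1 hs
  have hmem : ∀ w : ℕ, w = v ↔ w < 10 ∧ (mask σ).testBit w = false ∧
      N.testBit (mask σ ||| 1 <<< w) := by
    intro w
    rw [← mem_cofaceVertices, hl]
    simp
  obtain ⟨hv, hvσ, hvN⟩ := (hmem v).1 rfl
  obtain ⟨x, rfl⟩ : ∃ x : W, x.val = v := ⟨⟨v, hv⟩, rfl⟩
  have hxσ : x ∉ σ := by
    rw [testBit_mask] at hvσ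
    simpa using hvσ
  rw [← mask_insert] at hvN
  have hσne : σ.Nonempty := by
    rw [Finset.nonempty_iff_ne_empty]
    rintro rfl
    rw [mask_empty] at hs0
    exact hs0.ne rfl
  have hσK : σ ∈ K := (hK σ).2 ⟨hσne, hN⟩
  have hτK : insert x σ ∈ K := (hK _).2 ⟨Finset.insert_nonempty _ _, hvN⟩
  have hfree : ∀ y, y ∉ σ → insert y σ ∈ K → y = x := by
    intro y hy hyK
    refine Fin.ext ((hmem y).2 ⟨y.isLt, ?_, ?_⟩)
    · rw [testBit_mask]
      simpa using hy
    · rw [← mask_insert]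
      exact ((hK _).1 hyK).2
  refine ⟨⟨{ρ | ρ ∈ K ∧ ρ ≠ σ ∧ ρ ≠ insert x σ}, ?_⟩, ?_, fun h₀ =>
    h₀.of_collapse (fun ρ => Iff.rfl) hσne hxσ hτK hfree⟩
  · rintro ρ ⟨hρ, hρσ, hρτ⟩
    refine ⟨(K.isRelLowerSet_faces hρ).1, fun π hπ hne =>
      ⟨(K.isRelLowerSet_faces hρ).2 hπ hne, ?_⟩⟩
    -- Since `x` is the only vertex that extends `σ`, the faces that contain `σ` are just the two
    -- that are removed. What is left is therefore closed under passing to faces.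
    have key : ¬ σ ⊆ ρ := by
      intro hsub
      have h1 : ∀ y ∈ ρ, y ∉ σ → y = x := fun y hy hyσ => hfree y hyσ
        ((K.isRelLowerSet_faces hρ).2 (Finset.insert_subset hy hsub) (Finset.insert_nonempty _ _))
      by_cases hxρ : x ∈ ρ
      · refine hρτ (Finset.Subset.antisymm (fun y hy => ?_) (Finset.insert_subset hxρ hsub))
        rw [Finset.mem_insert]
        by_contra! h
        exact h.1 (h1 y hy h.2)
      · refine hρσ (Finset.Subset.antisymm (fun y hy => ?_) hsub)
        by_contra h
        exact hxρ (h1 y hy h ▸ hy)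
    constructor
    · rintro rfl
      exact key hπ
    · rintro rfl
      exact key ((Finset.subset_insert _ _).trans hπ)
  · intro ρ
    change (ρ ∈ K ∧ ρ ≠ σ ∧ ρ ≠ insert x σ) ↔ ρ.Nonempty ∧
      Nat.testBit (N ^^^ 1 <<< mask σ ^^^ 1 <<< (mask σ ||| 1 <<< x.val)) (mask ρ)
    rw [← mask_insert, Nat.testBit_xor, Nat.testBit_xor, testBit_one_shiftLeft,
      testBit_one_shiftLeft, hK]
    simp only [mask_injective.eq_iff]
    by_cases h1 : ρ = σ
    · have : σ ≠ insert x σ := fun h => hxσ (h ▸ Finset.mem_insert_self _ _)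
      subst h1
      simp [hN, this]
    · by_cases h2 : ρ = insert x σ
      · subst h2
        simp [hvN, h1]
      · simp [h1, h2]

/-- Acyclicity of the final vertex passes back along the collapses. The bound `k` and the order of
`l` affect only whether the test succeeds, not what success means. -/
theorem isAcyclic_of_isCollapsible {l : List ℕ} (hl : ∀ s ∈ l, 0 < s ∧ s < 1024) {k N : ℕ}
    (h : isCollapsible l k N = true) (hK : Encodes K N) : IsAcyclic K := by
  induction k generalizing K N with
  | zero => exact absurd h (by simp [isCollapsible])
  | succ k ih =>
    change (bif isVertex N then true else foldThen collapseStep (isCollapsible l k) l N) = true at h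
    cases hN : isVertex N
    · rw [hN, cond_false, foldThen_eq] at h
      have key : ∀ (l' : List ℕ), (∀ s ∈ l', 0 < s ∧ s < 1024) → ∀ (K) (N : ℕ), Encodes K N →
          ∃ K₀, Encodes K₀ (l'.foldl collapseStep N) ∧ (IsAcyclic K₀ → IsAcyclic K) := by
        intro l' hl'
        induction l' with
        | nil => exact fun K N hK => ⟨K, hK, id⟩
        | cons s l' ihl =>
          intro K N hK
          obtain ⟨K₁, h1, h2⟩ := exists_encodes_collapseStep (hl' s (by simp)).2
            (hl' s (by simp)).1 hK
          obtain ⟨K₂, h3, h4⟩ := ihl (fun s hs => hl' s (by simp [hs])) _ _ h1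
          exact ⟨K₂, h3, fun h => h2 (h4 h)⟩
      obtain ⟨K₀, h1, h2⟩ := key l hl K N hK
      exact h2 (ih h h1)
    · obtain ⟨p, hp, hNp⟩ := anyOf_eq_true.1 hN
      obtain ⟨x, rfl⟩ : ∃ x : W, x.val = p := ⟨⟨p, mem_vertices.1 hp⟩, rfl⟩
      obtain rfl : N = 1 <<< (1 <<< x.val) := Nat.eq_of_beq_eq_true hNp
      refine isAcyclic_of_forall_mem_iff (p := x) fun σ => ?_
      rw [hK, testBit_one_shiftLeft, ← mask_singleton]
      simp only [mask_injective.eq_iff, decide_eq_true_eq]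
      exact ⟨And.right, fun h => ⟨h ▸ Finset.singleton_nonempty x, h⟩⟩

theorem hasHomologyOfSphere_of_isSphere {l : List ℕ} (hl : ∀ s ∈ l, 0 < s ∧ s < 1024)
    (hK : ∀ σ, σ ∈ K ↔ mask σ ∈ l) {d : ℕ} (h : isSphere l d = true) :
    HasHomologyOfSphere ℤ K d := by
  rw [isSphere, foldThen_eq] at h
  set N := l.foldl (fun N s => Nat.lor N (Nat.shiftLeft 1 s)) 0 with hNdef
  have hN : ∀ s, N.testBit s ↔ s ∈ l := by
    intro s
    rw [hNdef, testBit_foldl_lor]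
    simp
  have hE : Encodes K N := by
    intro σ
    rw [hK, hN]
    refine ⟨fun h => ⟨?_, h⟩, And.right⟩
    rw [Finset.nonempty_iff_ne_empty]
    rintro rfl
    rw [mask_empty] at h
    exact (hl 0 h).1.ne rfl
  obtain ⟨s, hs, h⟩ := anyOf_eq_true.1 h
  obtain ⟨F, rfl⟩ := mask_lt_iff_exists.1 (hl s hs).2
  cases hd : Nat.beq (size (mask F)) (Nat.add d 1)
  · simp [hd] at h
  rw [hd, cond_true, Bool.and_eq_true, List.isEmpty_iff, force_eq] at h
  have hcard : F.card = d + 1 := by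
    rw [← size_mask]
    exact Nat.eq_of_beq_eq_true hd
  have hFK : F ∈ K := (hK F).2 hs
  have hmax : ∀ y, y ∉ F → insert y F ∉ K := by
    intro y hy hyK
    have : y.val ∈ cofaceVertices N (mask F) := by
      rw [mem_cofaceVertices, ← mask_insert]
      exact ⟨y.isLt, by rw [testBit_mask]; simpa using hy, ((hE _).1 hyK).2⟩
    rw [h.1] at this
    simp at this
  let K₀ : PreAbstractSimplicialComplex W := ⟨{ρ | ρ ∈ K ∧ ρ ≠ F}, by
    rintro ρ ⟨hρ, hρF⟩
    refine ⟨(K.isRelLowerSet_faces hρ).1, fun π hπ hne =>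
      ⟨(K.isRelLowerSet_faces hρ).2 hπ hne, ?_⟩⟩
    rintro rfl
    obtain ⟨y, hy, hyF⟩ := Finset.exists_of_ssubset (Finset.ssubset_iff_subset_ne.2 ⟨hπ, hρF.symm⟩)
    exact hmax y hyF ((K.isRelLowerSet_faces hρ).2 (Finset.insert_subset hy hπ)
      (Finset.insert_nonempty _ _))⟩
  refine hasHomologyOfSphere_of_isAcyclic_erase (K₀ := K₀)
    (isAcyclic_of_isCollapsible hl h.2 ?_) (fun ρ => Iff.rfl) hFK hcard hmax
  intro ρ
  change (ρ ∈ K ∧ ρ ≠ F) ↔ ρ.Nonempty ∧ Nat.testBit (N ^^^ 1 <<< mask F) (mask ρ)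
  rw [Nat.testBit_xor, testBit_one_shiftLeft, hE]
  simp only [mask_injective.eq_iff]
  by_cases h1 : ρ = F
  · subst h1
    simp [((hE _).1 hFK).2]
  · simp [h1]

theorem mem_link_iff_mem_linkFaces {l : List ℕ} (hl : ∀ s ∈ l, 0 < s ∧ s < 1024)
    (hK : ∀ σ, σ ∈ K ↔ mask σ ∈ l) (σ τ : Finset W) :
    τ ∈ link K σ ↔ mask τ ∈ linkFaces (mask σ) l := by
  rw [mem_linkFaces]
  -- For `σ ⊆ ρ` the symmetric difference is the set difference, so `linkFaces` computes the faces
  -- of the link.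
  have hxor : ∀ ρ : Finset W, σ ⊆ ρ → mask ρ ^^^ mask σ = mask (ρ \ σ) := by
    intro ρ hρ
    refine (mask_eq_of_testBit (Nat.xor_lt_two_pow (n := 10) (mask_lt _) (mask_lt _))
      fun i => ?_).symm
    rw [Nat.testBit_xor, testBit_mask, testBit_mask, Finset.mem_sdiff]
    by_cases h1 : i ∈ σ
    · simp [h1, hρ h1]
    · simp [h1]
  constructor
  · rintro ⟨hne, hd, hm⟩
    refine ⟨mask (τ ∪ σ), (hK _).1 hm, land_mask_eq_right.2 Finset.subset_union_right, ?_, ?_⟩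
    · rw [mask_injective.ne_iff]
      intro h
      obtain ⟨x, hx⟩ := hne
      exact Finset.disjoint_left.1 hd hx (h ▸ Finset.mem_union_left _ hx)
    · rw [hxor _ Finset.subset_union_right, Finset.union_sdiff_right, hd.sdiff_eq_left]
  · rintro ⟨u, hu, h1, h2, h3⟩
    obtain ⟨ρ, rfl⟩ := mask_lt_iff_exists.1 (hl u hu).2
    rw [land_mask_eq_right] at h1
    rw [hxor ρ h1, mask_injective.eq_iff] at h3
    rw [mask_injective.ne_iff] at h2
    subst h3
    refine ⟨?_, Finset.sdiff_disjoint, ?_⟩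
    · rw [Finset.sdiff_nonempty]
      exact fun h => h2 (Finset.Subset.antisymm h h1)
    · rw [Finset.sdiff_union_of_subset h1]
      exact (hK ρ).2 hu

theorem isHomologySphere_of_isSphereManifold {fs : List ℕ} (hfs : ∀ f ∈ fs, f < 1024 ∧ size f = 4)
    (hK : ∀ σ, σ ∈ K ↔ σ.Nonempty ∧ ∃ f ∈ fs, f &&& mask σ = mask σ)
    (h : isSphereManifold fs = true) : IsHomologySphere ℤ K 3 := by
  obtain ⟨l, h1, h2⟩ := facesThen_eq (fun l => Bool.and (isSphere l 3) (allOf (fun s =>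
    bif Nat.ble (size s) 3 then reverseThen (fun l => isSphere l (Nat.sub 3 (size s)))
      (linkFaces s l) [] else true) l)) fs 1023 []
  rw [isSphereManifold, h1, Bool.and_eq_true, allOf_eq_true] at h
  obtain ⟨h3, h4⟩ := h
  have hl : ∀ s ∈ l, 0 < s ∧ s < 1024 := by
    intro s hs
    rcases (h2 s).1 hs with h | ⟨h5, h6, -⟩
    · simp at h
    · exact ⟨h5, by omega⟩
  have hKl : ∀ σ, σ ∈ K ↔ mask σ ∈ l := by
    intro σ
    rw [hK, h2, Finset.nonempty_iff_ne_empty, Ne, ← mask_eq_zero]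
    have := mask_lt σ
    simp only [List.not_mem_nil, false_or, pos_iff_ne_zero]
    exact ⟨fun h => ⟨h.1, by omega, h.2⟩, fun h => ⟨h.1, h.2.2⟩⟩
  refine ⟨⟨fun σ hσ => ?_, fun σ hσ hcard => ?_⟩, hasHomologyOfSphere_of_isSphere hl hKl h3⟩
  · obtain ⟨-, f, hf, hfσ⟩ := (hK σ).1 hσ
    obtain ⟨hf1, hf2⟩ := hfs f hf
    obtain ⟨τ, rfl⟩ := mask_lt_iff_exists.1 hf1
    rw [size_mask] at hf2
    refine ⟨τ, (hK τ).2 ⟨Finset.card_pos.1 (by omega), mask τ, hf, Nat.and_self _⟩, ?_, hf2⟩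
    exact land_mask_eq_right.1 hfσ
  · have h5 := h4 _ ((hKl σ).1 hσ)
    rw [size_mask, Nat.ble_eq_true_of_le hcard, cond_true, reverseThen_eq, List.append_nil] at h5
    refine hasHomologyOfSphere_of_isSphere (fun s hs => ?_) (fun τ => ?_) h5
    · rw [List.mem_reverse, mem_linkFaces] at hs
      obtain ⟨u, hu, h6, h7, rfl⟩ := hs
      refine ⟨?_, Nat.xor_lt_two_pow (n := 10) (hl u hu).2 (mask_lt σ)⟩
      rw [pos_iff_ne_zero, Ne, Nat.xor_eq_zero_iff]
      exact h7
    · rw [List.mem_reverse]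
      exact mem_link_iff_mem_linkFaces hl hKl σ τ

end Soundness

/-! ### The action on masks, and the nine complexes as spheres. -/

theorem testBit_mask_iff {σ : Finset W} {j : ℕ} :
    (mask σ).testBit j ↔ ∃ x ∈ σ, x.val = j := by
  by_cases hj : j < 10
  · rw [testBit_mask σ ⟨j, hj⟩, decide_eq_true_iff]
    exact ⟨fun h => ⟨_, h, rfl⟩, by rintro ⟨x, hx, rfl⟩; exact hx⟩
  · rw [testBit_mask_of_le σ (not_lt.1 hj)]
    simp only [Bool.false_eq_true, false_iff]
    rintro ⟨x, -, rfl⟩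
    exact hj x.isLt

/-- The mask of the image of the set with mask `s` under `f`. -/
noncomputable def imageMask (f : ℕ → ℕ) (s : ℕ) : ℕ :=
  List.rec 0 (fun v _ ih => bif bit s v then Nat.lor (Nat.shiftLeft 1 (f v)) ih else ih) vertices

theorem mask_image {f : W → W} {f' : ℕ → ℕ} (h : ∀ x : W, f' x.val = (f x).val) (σ : Finset W) :
    mask (σ.image f) = imageMask f' (mask σ) := by
  have key : ∀ (l : List ℕ) (s j : ℕ), (List.rec 0 (fun v _ ih => bif bit s v then
      Nat.lor (Nat.shiftLeft 1 (f' v)) ih else ih) l : ℕ).testBit j ↔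
      ∃ v ∈ l, s.testBit v ∧ f' v = j := by
    intro l s j
    induction l with
    | nil => simp
    | cons v l ih =>
      rw [← bit_eq_testBit] at ih ⊢
      dsimp only
      cases hv : bit s v
      · rw [cond_false, ih]
        rw [bit_eq_testBit] at hv
        simp [hv]
      · rw [cond_true, bit_eq_testBit]
        change (1 <<< f' v ||| _).testBit j = true ↔ _
        rw [Nat.testBit_or, Bool.or_eq_true, ← bit_eq_testBit _ j, ← bit_eq_testBit _ j, ih]
        rw [bit_eq_testBit] at hv
        rw [bit_eq_testBit, testBit_one_shiftLeft]
        rw [decide_eq_true_iff, List.exists_mem_cons_iff, hv, eq_comm]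
        simp
  refine Nat.eq_of_testBit_eq fun j => ?_
  rw [Bool.eq_iff_iff, imageMask, key, testBit_mask_iff]
  simp only [Finset.mem_image, mem_vertices]
  constructor
  · rintro ⟨_, ⟨x, hx, rfl⟩, rfl⟩
    exact ⟨x, x.isLt, by simpa [testBit_mask] using hx, h x⟩
  · rintro ⟨v, hv, hvσ, rfl⟩
    obtain ⟨x, hx, rfl⟩ := testBit_mask_iff.1 hvσ
    exact ⟨f x, ⟨x, hx, rfl⟩, (h x).symm⟩

/-- The action of the `n`-th power of the generator of `C5` on the vertices as natural numbers. -/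
def rotate (n x : ℕ) : ℕ :=
  bif Nat.ble 5 (Nat.mod (Nat.add x 4) 10) then Nat.add (Nat.mod (Nat.add (Nat.add x 4) n) 5) 1
  else Nat.mod (Nat.add (Nat.mod (Nat.add (Nat.mod (Nat.add x 4) 10) n) 5) 6) 10

theorem rotate_eq : ∀ (g : C5) (x : W),
    rotate (Multiplicative.toAdd g).val x.val = (g • x).val := by
  decide +kernel

/-- The masks of the representatives of the orbits of facets of `L i`. -/
def representativeMasks : Fin 9 → List ℕ := ![
  [78, 86, 90, 92],
  [198, 204, 216, 240, 226],
  [202, 232, 228, 212, 210],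
  [198, 204, 202, 106, 108],
  [198, 204, 216, 210, 90, 106],
  [198, 204, 216, 210, 114, 120],
  [202, 204, 212, 210, 86, 108],
  [198, 204, 202, 332, 360, 356],
  [198, 204, 216, 210, 330, 360, 354]]

theorem mem_representativeMasks (i : Fin 9) (s : ℕ) :
    s ∈ representativeMasks i ↔ ∃ τ ∈ representatives i, mask τ = s := by
  have h : ∀ i, (representatives i).image mask = (representativeMasks i).toFinset := by
    decide +kernel
  rw [← List.mem_toFinset, ← h, Finset.mem_image]

/-- The translates under `C5` of the masks in a list. -/
noncomputable def translates (l : List ℕ) : List ℕ :=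
  l.flatMap fun s => [0, 1, 2, 3, 4].map fun n => imageMask (rotate n) s

theorem mem_translates {l : List ℕ} {s : ℕ} :
    s ∈ translates l ↔ ∃ t ∈ l, ∃ n < 5, imageMask (rotate n) t = s := by
  have h : ∀ n, n ∈ [0, 1, 2, 3, 4] ↔ n < 5 := by
    intro n
    constructor
    · revert n
      decide
    · intro hn
      interval_cases n <;> decide
  simp only [translates, List.mem_flatMap, List.mem_map, h]

theorem mem_translates_mask {l : List ℕ} {s : ℕ} :
    s ∈ translates l ↔ ∃ t ∈ l, ∃ g : C5,
      imageMask (rotate (Multiplicative.toAdd g).val) t = s := by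
  rw [mem_translates]
  refine exists_congr fun t => and_congr_right fun _ => ⟨?_, ?_⟩
  · rintro ⟨n, hn, h⟩
    refine ⟨Multiplicative.ofAdd (n : ZMod 5), ?_⟩
    rwa [toAdd_ofAdd, ZMod.val_natCast_of_lt hn]
  · rintro ⟨g, h⟩
    exact ⟨_, ZMod.val_lt _, h⟩

theorem mem_L_iff (i : Fin 9) (σ : Finset W) : σ ∈ L i ↔
    σ.Nonempty ∧ ∃ f ∈ translates (representativeMasks i), f &&& mask σ = mask σ := by
  change (σ.Nonempty ∧ ∃ τ ∈ representatives i, ∃ g : C5, σ ⊆ τ.image (fun x => g • x)) ↔ _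
  simp only [mem_translates_mask, mem_representativeMasks]
  refine and_congr_right fun _ => ⟨?_, ?_⟩
  · rintro ⟨τ, hτ, g, h⟩
    refine ⟨_, ⟨_, ⟨τ, hτ, rfl⟩, g, rfl⟩, ?_⟩
    rwa [← mask_image (fun x => rotate_eq g x), land_mask_eq_right]
  · rintro ⟨_, ⟨_, ⟨τ, hτ, rfl⟩, g, rfl⟩, h⟩
    refine ⟨τ, hτ, g, ?_⟩
    rwa [← mask_image (fun x => rotate_eq g x), land_mask_eq_right] at h

theorem isSimplicialAction_L (i : Fin 9) : IsSimplicialAction C5 (L i) := by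
  rintro g σ ⟨hne, τ, hτ, h, hσ⟩
  refine ⟨hne.image _, τ, hτ, g * h, (Finset.image_subset_image hσ).trans ?_⟩
  rw [Finset.image_image]
  exact (Finset.image_congr fun x _ => (mul_smul g h x).symm).subset

/-- The number `961` is the mask of `{6, …, 10}`. The last bound excludes triangles inside the
second orbit. -/
theorem facets_L : ∀ i, ∀ f ∈ translates (representativeMasks i),
    f < 1024 ∧ size f = 4 ∧ size (f &&& 961) ≤ 2 := by
  decide +kernel

/-- Here `reverseThen` serves to pass on an evaluated list of facets; their order does not matter.
-/
theorem isSphereManifold_L : ∀ i,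
    reverseThen isSphereManifold (translates (representativeMasks i)) [] = true := by
  decide +kernel

theorem isHomologySphere_L (i : Fin 9) :
    IsHomologySphere ℤ (L i).toPreAbstractSimplicialComplex 3 := by
  have h := isSphereManifold_L i
  rw [reverseThen_eq, List.append_nil] at h
  refine isHomologySphere_of_isSphereManifold (fun f hf => ?_) (fun σ => ?_) h
  · have := facets_L i f (List.mem_reverse.1 hf)
    exact ⟨this.1, this.2.1⟩
  · simp only [List.mem_reverse]
    exact mem_L_iff i σ

/-- The vertices `6, …, 10`. -/
def secondOrbit : Finset W := {6, 7, 8, 9, 0}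

theorem mask_secondOrbit : mask secondOrbit = 961 := by decide +kernel

theorem coe_secondOrbit : (secondOrbit : Set W) = MulAction.orbit C5 (6 : W) := by
  ext x
  rw [MulAction.mem_orbit_iff, Finset.mem_coe]
  revert x
  decide +kernel

theorem mask_inter (σ τ : Finset W) : mask (σ ∩ τ) = mask σ &&& mask τ := by
  refine mask_eq_of_testBit (Nat.and_le_left.trans_lt (mask_lt σ)) fun i => ?_
  rw [Nat.testBit_and, testBit_mask, testBit_mask]
  simp

theorem not_subset_secondOrbit_L {i : Fin 9} {σ : Finset W} (hσ : σ ∈ L i) (h3 : σ.card = 3) :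
    ¬ σ ⊆ secondOrbit := by
  intro hsub
  obtain ⟨-, f, hf, hfσ⟩ := (mem_L_iff i σ).1 hσ
  obtain ⟨h1, -, h2⟩ := facets_L i f hf
  obtain ⟨τ, rfl⟩ := mask_lt_iff_exists.1 h1
  rw [← mask_secondOrbit, ← mask_inter, size_mask] at h2
  have := Finset.card_le_card (Finset.subset_inter (land_mask_eq_right.1 hfσ) hsub)
  omega

theorem isTwoOrbitSphere_L (i : Fin 9) : IsTwoOrbitSphere (L i) where
  card_eq := rfl
  simplicial := isSimplicialAction_L i
  sphere := isHomologySphere_L i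
  orbits := by
    have h : ∀ a : W, MulAction.orbit C5 a = (Finset.univ.image fun g : C5 => g • a) := by
      intro a
      ext x
      simp [MulAction.mem_orbit_iff]
    refine ⟨1, 6, ?_⟩
    simp only [h, ← Finset.coe_union, Finset.coe_eq_univ, Finset.disjoint_coe, Set.ncard_coe_finset]
    decide +kernel
  no_triangle := ⟨6, fun σ hσ h3 => by
    rw [← coe_secondOrbit, Finset.coe_subset]
    exact not_subset_secondOrbit_L hσ h3⟩

/-! ### Normalisation of the vertex set and changes of labels. -/

section Candidates

/-- The combinatorial properties of the complexes to be classified, when their vertices are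
labelled so that `6, …, 10` is the orbit without triangles. -/
structure IsCandidate (K : AbstractSimplicialComplex W) : Prop where
  sphereLike : IsSphereLike K.toPreAbstractSimplicialComplex
  simplicial : IsSimplicialAction C5 K
  no_triangle : ∀ σ ∈ K, σ.card = 3 → ¬ σ ⊆ secondOrbit

/-- The complex on `α` that corresponds to `K` under a bijection. -/
def comap {α : Type*} {β : Type*} (e : α ≃ β) (K : AbstractSimplicialComplex β) :
    AbstractSimplicialComplex α where
  faces := {σ | σ.map e.toEmbedding ∈ K}
  isRelLowerSet_faces := fun σ hσ => by
    have h := K.isRelLowerSet_faces hσ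
    exact ⟨Finset.map_nonempty.1 h.1, fun ρ hρ hne =>
      h.2 (Finset.map_subset_map.2 hρ) (Finset.map_nonempty.2 hne)⟩
  singleton_mem := fun x => by
    change Finset.map _ {x} ∈ K
    rw [Finset.map_singleton]
    exact K.singleton_mem _

theorem mem_comap {α : Type*} {β : Type*} {e : α ≃ β} {K : AbstractSimplicialComplex β}
    {σ : Finset α} : σ ∈ comap e K ↔ σ.map e.toEmbedding ∈ K := Iff.rfl

theorem isSphereLike_comap {α : Type u} {β : Type v} [DecidableEq α] [DecidableEq β] (e : α ≃ β)
    {K : AbstractSimplicialComplex β} (hK : IsSphereLike K.toPreAbstractSimplicialComplex) :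
    IsSphereLike (comap e K).toPreAbstractSimplicialComplex := by
  have hmem : ∀ σ, σ ∈ (comap e K).toPreAbstractSimplicialComplex ↔
    σ.map e.toEmbedding ∈ K.toPreAbstractSimplicialComplex := fun σ => Iff.rfl
  have hsymm : ∀ τ : Finset β, (τ.map e.symm.toEmbedding).map e.toEmbedding = τ := by
    intro τ
    ext x
    simp
  refine ⟨fun σ hσ => ?_, fun σ hσ h3 => ?_,
    fun σ h1 hσ c hanti hc x y z hxy hyz hzx hd h1 h2 h3 => ?_⟩
  · obtain ⟨τ, hτ, hsub, h4⟩ := hK.pure _ hσ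
    refine ⟨τ.map e.symm.toEmbedding, ?_, ?_, by rw [Finset.card_map, h4]⟩
    · rwa [hmem, hsymm]
    · rw [← Finset.map_subset_map (f := e.toEmbedding), hsymm]
      exact hsub
  · rw [← hK.triangle _ hσ (by rw [Finset.card_map, h3])]
    rw [← Set.ncard_image_of_injective _ e.injective]
    congr 1
    ext x
    obtain ⟨y, rfl⟩ := e.surjective x
    rw [e.injective.mem_set_image]
    change (y ∉ σ ∧ insert y σ ∈ (comap e K).toPreAbstractSimplicialComplex) ↔
      (e y ∉ σ.map e.toEmbedding ∧ insert (e y) (σ.map e.toEmbedding) ∈ _)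
    rw [hmem, Finset.map_insert]
    simp
  · have hpair : ∀ x y : α, ({x, y} ∪ σ).map e.toEmbedding = {e x, e y} ∪ σ.map e.toEmbedding := by
      intro x y
      rw [Finset.map_union, Finset.map_insert, Finset.map_singleton]
      rfl
    have htriple : ∀ x y z : α, ({x, y, z} : Finset α).map e.toEmbedding = {e x, e y, e z} := by
      intro x y z
      rw [Finset.map_insert, Finset.map_insert, Finset.map_singleton]
      rfl
    rw [hmem, hpair] at h1 h2 h3
    have := hK.period (σ.map e.toEmbedding) (by rwa [Finset.card_map])
      (hσ.imp (fun h => by rw [h, Finset.map_empty]) id) (fun x y => c (e.symm x) (e.symm y))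
      (fun x y => hanti _ _) (fun x y z hd hm => ?_) (e x) (e y) (e z) (e.injective.ne hxy)
      (e.injective.ne hyz) (e.injective.ne hzx) ?_ h1 h2 h3
    · simpa using this
    · obtain ⟨x, rfl⟩ := e.surjective x
      obtain ⟨y, rfl⟩ := e.surjective y
      obtain ⟨z, rfl⟩ := e.surjective z
      simp only [Equiv.symm_apply_apply]
      rw [← htriple, Finset.disjoint_map] at hd
      rw [← htriple, ← Finset.map_union] at hm
      exact hc x y z hd hm
    · rwa [← htriple, Finset.disjoint_map]

theorem isSimplicialAction_comap {α : Type*} {β : Type*} [DecidableEq α] [DecidableEq β]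
    [MulAction C5 α] [MulAction C5 β] {e : α ≃ β} {φ : C5 ≃* C5}
    (he : ∀ (g : C5) (x : α), e (g • x) = φ g • e x) {K : AbstractSimplicialComplex β}
    (hK : IsSimplicialAction C5 K) : IsSimplicialAction C5 (comap e K) := by
  intro g σ hσ
  have := hK (φ g) _ hσ
  rw [mem_comap]
  convert this using 1
  simp only [Finset.map_eq_image, Finset.image_image]
  exact Finset.image_congr fun x _ => he g x

theorem weaklyIsomorphic_comap {α : Type*} {β : Type*} [MulAction C5 α] [MulAction C5 β]
    {e : α ≃ β} {φ : C5 ≃* C5} (he : ∀ (g : C5) (x : α), e (g • x) = φ g • e x)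
    (K : AbstractSimplicialComplex β) : WeaklyIsomorphic C5 K (comap e K) := by
  refine ⟨e.symm, φ.symm, fun σ => ?_, fun g x => ?_⟩
  · rw [mem_comap, Finset.map_map]
    convert Iff.rfl
    ext x
    simp
  · rw [Equiv.symm_apply_eq, he]
    simp

theorem WeaklyIsomorphic.trans {α β γ : Type*} [MulAction C5 α] [MulAction C5 β] [MulAction C5 γ]
    {K : AbstractSimplicialComplex α} {M : AbstractSimplicialComplex β}
    {N : AbstractSimplicialComplex γ} (h₁ : WeaklyIsomorphic C5 K M)
    (h₂ : WeaklyIsomorphic C5 M N) : WeaklyIsomorphic C5 K N := by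
  obtain ⟨f, φ, hf, hφ⟩ := h₁
  obtain ⟨f', φ', hf', hφ'⟩ := h₂
  refine ⟨f.trans f', φ.trans φ', fun σ => ?_, fun g x => ?_⟩
  · rw [hf, hf', Finset.map_map]
    rfl
  · simp [hφ, hφ']

/-- The exponent of the generator that moves `1` or `6` to a given vertex. -/
def position : W → ZMod 5 := ![4, 0, 1, 2, 3, 4, 0, 1, 2, 3]

/-- Base points `a` and `b` in the two orbits, with `b` in an orbit without triangles, identify the
vertex set equivariantly with `W`: `1` goes to `a` and `6` to `b`. -/
theorem IsTwoOrbitSphere.exists_isCandidate {V : Type u} [Fintype V] [DecidableEq V]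
    [MulAction C5 V] {K : AbstractSimplicialComplex V} (hK : IsTwoOrbitSphere K) :
    ∃ M : AbstractSimplicialComplex W, IsCandidate M ∧ WeaklyIsomorphic C5 K M := by
  obtain ⟨a, b, hunion, hb⟩ : ∃ a b : V, MulAction.orbit C5 a ∪ MulAction.orbit C5 b = Set.univ ∧
      ∀ σ ∈ K, σ.card = 3 → ¬ (σ : Set V) ⊆ MulAction.orbit C5 b := by
    obtain ⟨a, b, h, -, -, -⟩ := hK.orbits
    obtain ⟨d, hd⟩ := hK.no_triangle
    have : d ∈ MulAction.orbit C5 a ∪ MulAction.orbit C5 b := h ▸ Set.mem_univ d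
    rcases this with h' | h'
    · exact ⟨b, d, by rw [MulAction.orbit_eq_iff.2 h', Set.union_comm, h], hd⟩
    · exact ⟨a, d, by rw [MulAction.orbit_eq_iff.2 h', h], hd⟩
  let f : W → V := fun x => Multiplicative.ofAdd (position x) • if x ∈ secondOrbit then b else a
  have hsurj : Function.Surjective f := by
    have key : ∀ g : C5, ∃ x y : W, x ∉ secondOrbit ∧ y ∈ secondOrbit ∧
        Multiplicative.ofAdd (position x) = g ∧ Multiplicative.ofAdd (position y) = g := by
      decide +kernel
    intro v
    have : v ∈ MulAction.orbit C5 a ∪ MulAction.orbit C5 b := hunion ▸ Set.mem_univ v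
    rcases this with ⟨g, rfl⟩ | ⟨g, rfl⟩ <;> obtain ⟨x, y, hx, hy, hxg, hyg⟩ := key g
    · exact ⟨x, by simp [f, hx, hxg]⟩
    · exact ⟨y, by simp [f, hy, hyg]⟩
  -- The two orbits cover `V`, so `f` is onto; as both sides have ten elements it is bijective.
  let e : W ≃ V := Equiv.ofBijective f
    ((Fintype.bijective_iff_surjective_and_card f).2 ⟨hsurj, hK.card_eq.symm⟩)
  have he : ∀ (g : C5) (x : W), e (g • x) = MulEquiv.refl C5 g • e x := by
    have key : ∀ (g : C5) (x : W), (g • x ∈ secondOrbit ↔ x ∈ secondOrbit) ∧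
        Multiplicative.ofAdd (position (g • x)) = g * Multiplicative.ofAdd (position x) := by
      decide +kernel
    intro g x
    change f (g • x) = g • f x
    simp only [f, key, mul_smul]
  refine ⟨comap e K, ⟨isSphereLike_comap e hK.sphere.isSphereLike,
    isSimplicialAction_comap he hK.simplicial, fun σ hσ h3 hsub => ?_⟩, weaklyIsomorphic_comap he K⟩
  refine hb _ hσ (by rw [Finset.card_map, h3]) fun v hv => ?_
  obtain ⟨x, hx, rfl⟩ := Finset.mem_map.1 hv
  exact ⟨_, (congrArg (_ • ·) (if_pos (hsub hx))).symm⟩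

/-- The map of vertices, as natural numbers, that multiplies the positions in both orbits by `k` and
then adds `t` in the second orbit. -/
def relabel (k t x : ℕ) : ℕ :=
  bif Nat.ble 5 (Nat.mod (Nat.add x 4) 10) then Nat.add (Nat.mod (Nat.mul (Nat.add x 4) k) 5) 1
  else Nat.mod (Nat.add (Nat.mod (Nat.add (Nat.mul (Nat.mod (Nat.add x 4) 10) k) t) 5) 6) 10

/-- Up to the action of `C5` these are all the weakly equivariant bijections that preserve both
orbits. The automorphism `φ` is the `k`-th power map. -/
theorem exists_relabel_equiv {k t : ℕ} (hk : k ∈ [1, 2, 3, 4]) (ht : t ∈ [0, 1, 2, 3, 4]) :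
    ∃ (f : W ≃ W) (φ : C5 ≃* C5), (∀ x : W, relabel k t x.val = (f x).val) ∧
      (∀ (g : C5) (x : W), f (g • x) = φ g • f x) ∧ ∀ x, f x ∈ secondOrbit ↔ x ∈ secondOrbit := by
  have key : ∀ k ∈ [1, 2, 3, 4], ∀ t ∈ [0, 1, 2, 3, 4],
      (Function.Injective fun x : W => (Fin.ofNat 10 (relabel k t x.val) : W)) ∧
      (Function.Injective fun g : C5 => g ^ k) ∧
      (∀ x : W, relabel k t x.val = (Fin.ofNat 10 (relabel k t x.val) : W).val) ∧
      (∀ (g : C5) (x : W), (Fin.ofNat 10 (relabel k t (g • x).val) : W) =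
        g ^ k • (Fin.ofNat 10 (relabel k t x.val) : W)) ∧
      ∀ x : W, (Fin.ofNat 10 (relabel k t x.val) : W) ∈ secondOrbit ↔ x ∈ secondOrbit := by
    decide +kernel
  obtain ⟨h1, h2, h3, h4, h5⟩ := key k hk t ht
  exact ⟨Equiv.ofBijective _ (Finite.injective_iff_bijective.1 h1),
    MulEquiv.ofBijective (powMonoidHom k) (Finite.injective_iff_bijective.1 h2), h3, h4, h5⟩

theorem IsCandidate.comap {K : AbstractSimplicialComplex W} (hK : IsCandidate K) {f : W ≃ W}
    {φ : C5 ≃* C5} (hf : ∀ (g : C5) (x : W), f (g • x) = φ g • f x)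
    (h : ∀ x, f x ∈ secondOrbit ↔ x ∈ secondOrbit) : IsCandidate (comap f K) := by
  refine ⟨isSphereLike_comap f hK.sphereLike, isSimplicialAction_comap hf hK.simplicial,
    fun σ hσ h3 hsub => hK.no_triangle _ hσ (by rw [Finset.card_map, h3]) fun y hy => ?_⟩
  obtain ⟨x, hx, rfl⟩ := Finset.mem_map.1 hy
  exact (h x).2 (hsub hx)

theorem isCandidate_L (i : Fin 9) : IsCandidate (L i) :=
  ⟨(isHomologySphere_L i).isSphereLike, isSimplicialAction_L i,
    fun _ hσ h3 => not_subset_secondOrbit_L hσ h3⟩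

end Candidates

/-! ### Orbits of tetrahedra, the search and the obstructions. -/

section Kernel

/-- Representatives of the orbits of the sets of four vertices at most two of which are among
`6, …, 10`. -/
def orbitMasks : List ℕ :=
  [30, 39, 51, 57, 29, 15, 43, 53, 27, 45, 23, 99, 163, 141, 71, 113, 177, 135, 89, 153, 77,
   101, 165, 149, 75, 83, 147, 139, 105, 169, 85]

/-- The least mask in the orbit of `s`. -/
noncomputable def canonicalMask (s : ℕ) : ℕ :=
  List.rec s (fun n _ ih => bif Nat.ble (imageMask (rotate n) s) ih then imageMask (rotate n) s
    else ih) [1, 2, 3, 4]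

/-- The index of the first entry `c` of `l`. -/
noncomputable def indexIn (c : ℕ) (l : List ℕ) : ℕ :=
  List.rec 0 (fun x _ ih => bif Nat.beq x c then 0 else Nat.succ ih) l

/-- The index of the representative of the orbit of `s`, or `31`. -/
noncomputable def orbitIndex (s : ℕ) : ℕ := indexIn (canonicalMask s) orbitMasks

/-- The binary digit of `N` at `n` as a number. -/
def digit (N n : ℕ) : ℕ := Nat.land (Nat.shiftRight N n) 1

/-- The sum of the binary digits of `x` at the positions in `r`. -/
noncomputable def count (x : ℕ) (r : List ℕ) : ℕ :=
  List.rec 0 (fun j _ ih => Nat.add (digit x j) ih) r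

/-- The indices of the orbits of the tetrahedra, with vertex to be added in `l`, that contain the
triangle `s`. -/
noncomputable def rowOn (s : ℕ) (l : List ℕ) : List ℕ :=
  List.rec [] (fun v _ ih => bif bit s v then ih else
    bif Nat.ble 31 (orbitIndex (Nat.lor s (Nat.shiftLeft 1 v))) then ih
    else orbitIndex (Nat.lor s (Nat.shiftLeft 1 v)) :: ih) l

/-- Representatives of the orbits of triangles not contained in the second orbit. -/
def triangleMasks : List ℕ :=
  [14, 22, 35, 49, 25, 13, 7, 37, 19, 41, 21, 11, 97, 161, 133, 67, 81, 145, 131, 73, 137, 69]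

/-- The indices of the orbits of tetrahedra that contain a given triangle. -/
def rows : List (List ℕ) :=
  [[5, 0, 0, 1, 2, 3, 4],
   [10, 0, 0, 6, 7, 8, 9],
   [1, 6, 2, 11, 12, 13, 14],
   [2, 7, 3, 15, 16, 17, 11],
   [8, 4, 3, 18, 19, 12, 15],
   [5, 4, 9, 20, 13, 16, 18],
   [5, 10, 1, 14, 17, 19, 20],
   [1, 9, 7, 21, 22, 23, 24],
   [10, 8, 2, 25, 26, 27, 21],
   [6, 9, 3, 28, 29, 22, 25],
   [10, 4, 7, 30, 23, 26, 28],
   [5, 8, 6, 24, 27, 29, 30],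
   [11, 21, 28, 15],
   [12, 22, 29, 16],
   [17, 13, 23, 22],
   [14, 24, 25, 11],
   [25, 30, 18, 15],
   [26, 23, 19, 16],
   [17, 27, 26, 12],
   [24, 20, 18, 28],
   [27, 13, 19, 29],
   [14, 20, 30, 21]]

/-- The rows are multisets: `{1, 2, 3}` lies in `{1, 2, 3, 4}` and `{1, 2, 3, 5}`, which belong to
the same orbit, so the index `0` occurs twice. Tetrahedra with three vertices in the second orbit
have index `31` and are left out. -/
theorem map_rowOn_triangleMasks : (triangleMasks.map fun s => rowOn s vertices) = rows := by
  decide +kernel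

/-- The entries of `rows` that contain `k`. -/
noncomputable def rowsThrough (k : ℕ) : List (List ℕ) :=
  List.rec [] (fun r _ ih => bif anyOf (Nat.beq k) r then r :: ih else ih) rows

/-- Check that a choice `m` of some of the first `k + 1` orbits is not yet known to be wrong for one
of the triangles in the `k`-th orbit. -/
noncomputable def isConsistent (k m : ℕ) : Bool :=
  allOf (fun r => Bool.and (Nat.ble (count m r) 2)
    (Bool.or (Bool.not (Nat.beq (count m r) 1)) (anyOf (fun j => Nat.blt k j) r))) (rowsThrough k)

/-- Check `p` for all consistent extensions of a choice along the list `l` of levels. -/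
noncomputable def search (p : ℕ → Bool) (l : List ℕ) : ℕ → Bool :=
  List.rec p (fun k _ ih m => Bool.and (bif isConsistent k m then ih m else true)
    (force (Nat.lor m (Nat.shiftLeft 1 k)) fun m => bif isConsistent k m then ih m else true)) l

/-- The images of the indices of orbits under a change of labels. -/
noncomputable def orbitPermutation (k t : ℕ) : List ℕ :=
  List.rec [] (fun s _ ih => orbitIndex (imageMask (relabel k t) s) :: ih) orbitMasks

/-- The choice `x` of orbits after a change of labels. -/
noncomputable def relabelState (l : List ℕ) (x : ℕ) : ℕ :=
  List.rec 0 (fun j _ ih => Nat.add (Nat.mul 2 ih) (digit x j)) l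

/-- The number whose binary digits are the values of `p` on `l`. -/
noncomputable def numberOf (p : ℕ → Bool) (l : List ℕ) : ℕ :=
  List.rec 0 (fun s _ ih => Nat.add (Nat.mul 2 ih) (bif p s then 1 else 0)) l

/-- The choice of orbits of facets for `L i`. -/
noncomputable def stateL (i : Fin 9) : ℕ :=
  numberOf (fun s => anyOf (fun f => Nat.beq (Nat.land f s) s) (translates (representativeMasks i)))
    orbitMasks

/-- A cocycle on the link of the set with mask `face` and a triangle on which its sum is not zero. A
list entry with decimal digits `x`, `y` means that the cocycle takes the value `1` on the edge from
`x` to `y`. -/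
structure Obstruction where
  state : ℕ
  face : ℕ
  cocycle : List ℕ
  x : ℕ
  y : ℕ
  z : ℕ

/-- Choices of orbits of facets that do not give a homology sphere. -/
def obstructions : List Obstruction :=
  [⟨733185, 2, [25, 35, 45], 2, 5, 6⟩,
   ⟨1361921, 2, [25, 35, 45], 2, 5, 6⟩,
   ⟨2116016, 2, [35, 36, 37], 2, 3, 5⟩,
   ⟨2116392, 2, [53, 54, 58, 63, 64, 73], 2, 5, 3⟩,
   ⟨4329482, 2, [64, 65, 69], 2, 6, 5⟩,
   ⟨4329712, 2, [25, 28, 63, 65, 68, 95], 2, 5, 3⟩,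
   ⟨4331028, 2, [50, 54, 57], 2, 5, 4⟩,
   ⟨19185700, 2, [40, 50, 90], 2, 5, 0⟩,
   ⟨19925028, 0, [3, 13, 17, 23, 24, 27, 28, 63, 64, 67], 1, 2, 4⟩,
   ⟨19926104, 2, [30, 50, 60], 2, 3, 0⟩,
   ⟨40030208, 0, [13, 18, 23, 24, 28, 29, 63, 68, 73, 74, 78, 79], 1, 2, 4⟩,
   ⟨40030209, 2, [36, 37, 38], 2, 3, 6⟩,
   ⟨40493056, 2, [63, 65, 67, 68], 2, 6, 7⟩,
   ⟨40493057, 2, [36, 37, 38], 2, 3, 6⟩,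
   ⟨41293824, 2, [60, 64, 65, 69], 2, 6, 9⟩,
   ⟨41293825, 2, [36, 37, 38], 2, 3, 6⟩,
   ⟨42511872, 2, [26, 75, 76, 93, 95, 96], 2, 6, 4⟩,
   ⟨53510184, 2, [84, 85, 89], 2, 8, 5⟩,
   ⟨54923300, 2, [25, 65, 95], 2, 5, 7⟩,
   ⟨59184192, 2, [43, 73, 83], 3, 5, 7⟩,
   ⟨77744129, 2, [40, 47, 49], 2, 4, 7⟩,
   ⟨79069185, 2, [40, 47, 49], 2, 4, 7⟩,
   ⟨114577408, 2, [39, 49, 69, 79], 2, 6, 9⟩,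
   ⟨114577409, 2, [24, 34, 54], 2, 4, 6⟩,
   ⟨189726720, 2, [38, 58, 68, 78], 2, 7, 8⟩,
   ⟨189726721, 2, [24, 34, 54], 2, 4, 8⟩,
   ⟨280170816, 2, [50, 53, 57], 3, 6, 5⟩,
   ⟨280502284, 2, [40, 49, 50, 58, 59, 79], 2, 5, 8⟩,
   ⟨312954880, 2, [2, 7, 57, 58, 62, 68], 2, 7, 6⟩,
   ⟨312954881, 2, [23, 43, 53], 2, 3, 6⟩,
   ⟨752142336, 2, [63, 64, 68, 69], 2, 6, 8⟩,
   ⟨752142337, 2, [23, 43, 53], 2, 3, 6⟩,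
   ⟨1395339264, 2, [60, 63, 64, 67], 2, 6, 7⟩,
   ⟨1395339265, 2, [23, 43, 53], 2, 3, 6⟩]

/-- The cocycle with positive values given by `P` has sum zero along `x`, `y`, `z`. -/
def isBalanced (P x y z : ℕ) : Bool :=
  Nat.beq
    (Nat.add (Nat.add (digit P (10 * x + y)) (digit P (10 * y + z))) (digit P (10 * z + x)))
    (Nat.add (Nat.add (digit P (10 * y + x)) (digit P (10 * z + y))) (digit P (10 * x + z)))

/-- The vertices in a mask. -/
noncomputable def elements (s : ℕ) : List ℕ :=
  List.rec [] (fun v _ ih => bif bit s v then v :: ih else ih) vertices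

/-- Check that `s` is contained in a facet of the complex given by the choice `n`. -/
noncomputable def isFace (n s : ℕ) : Bool :=
  anyOf (fun f => Bool.and (bit n (orbitIndex f)) (Nat.beq (Nat.land f s) s))
    (translates orbitMasks)

/-- Check the cocycle condition for `P` on the link of `s` in the complex given by `n`. -/
noncomputable def isCocycle (n s P : ℕ) : Bool :=
  allOf (fun f => bif Bool.and (bit n (orbitIndex f)) (Nat.beq (Nat.land f s) s) then
    (fun l => allOf (fun x => allOf (fun y => allOf (isBalanced P x y) l) l) l)
      (elements (Nat.xor f s)) else true) (translates orbitMasks)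

/-- The mask of the union of the set with mask `s` and `{x, y}`. -/
noncomputable def pairMask (s x y : ℕ) : ℕ :=
  Nat.lor (Nat.shiftLeft 1 x) (Nat.lor (Nat.shiftLeft 1 y) s)

/-- Check that an obstruction is valid. -/
noncomputable def isObstruction (o : Obstruction) : Bool :=
  foldThen (fun N s => Nat.lor N (Nat.shiftLeft 1 s)) (fun P =>
    Bool.and (Bool.and (Nat.blt o.face 1024) (Nat.ble (size o.face) 1)) (Bool.and
      (isCocycle o.state o.face P) (Bool.and (Bool.not (isBalanced P o.x o.y o.z))
        (Bool.and (allOf (fun v => Bool.and (Nat.blt v 10) (Bool.not (bit o.face v)))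
          [o.x, o.y, o.z])
        (Bool.and (Bool.and (Bool.not (Nat.beq o.x o.y)) (Bool.and (Bool.not (Nat.beq o.y o.z))
            (Bool.not (Nat.beq o.z o.x))))
          (Bool.and (isFace o.state (pairMask o.face o.x o.y))
            (Bool.and (isFace o.state (pairMask o.face o.y o.z))
              (isFace o.state (pairMask o.face o.z o.x))))))))) o.cocycle 0

/-- The listed values of `face` are `2`, for the link of the vertex `1`, and `0`, for the complex
itself. -/
theorem isObstruction_of_mem : ∀ o ∈ obstructions, isObstruction o = true := by
  rw [← allOf_eq_true]
  decide +kernel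

/-- Check that a choice is `0` or `1`, or becomes one of the known ones after a change of labels. -/
noncomputable def isKnown (x : ℕ) : Bool :=
  Bool.or (Nat.ble x 1) (anyOf (fun k => anyOf (fun t =>
    force (relabelState (orbitPermutation k t) x) fun y => Bool.or (anyOf (fun i => Nat.beq y (stateL i)) (List.finRange 9))
      (anyOf (fun o : Obstruction => Nat.beq y o.state) obstructions))
    [0, 1, 2, 3, 4]) [1, 2, 3, 4])

/-- The indices of the orbits of sets of four vertices. -/
def levels : List ℕ :=
  [0, 1, 2, 3, 4, 5, 6, 7, 8, 9, 10, 11, 12, 13, 14, 15, 16, 17, 18, 19, 20, 21, 22, 23, 24, 25, 26,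
   27, 28, 29, 30]

/-- The finite core of the classification. A branch is abandoned once some triangle has more than
two cofaces, or exactly one with none of its orbits left to decide. -/
theorem search_isKnown : search isKnown levels 0 = true := by
  decide +kernel

end Kernel

/-! ### Every candidate is one of the nine complexes. -/

section Classification

theorem digit_eq (N n : ℕ) : digit N n = (N.testBit n).toNat := by
  have h : digit N n = (N >>> n) &&& 1 := rfl
  rw [h, Nat.and_one_is_mod, Nat.testBit, Nat.and_comm 1, Nat.and_one_is_mod]
  rcases Nat.mod_two_eq_zero_or_one (N >>> n) with h | h <;> simp [h]

theorem numberOf_cons (p : ℕ → Bool) (s : ℕ) (l : List ℕ) :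
    numberOf p (s :: l) = 2 * numberOf p l + (p s).toNat := by
  change 2 * numberOf p l + (bif p s then 1 else 0) = _
  cases p s <;> rfl

theorem numberOf_congr {p q : ℕ → Bool} {l : List ℕ} (h : ∀ s ∈ l, p s = q s) :
    numberOf p l = numberOf q l := by
  induction l with
  | nil => rfl
  | cons s l ih =>
    rw [numberOf_cons, numberOf_cons, h s (by simp), ih fun t ht => h t (by simp [ht])]

theorem testBit_numberOf (p : ℕ → Bool) (l : List ℕ) (i : ℕ) :
    (numberOf p l).testBit i = (l[i]?.map p).getD false := by
  induction l generalizing i with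
  | nil =>
    change Nat.testBit 0 i = _
    simp
  | cons s l ih =>
    rw [numberOf_cons]
    cases i with
    | zero =>
      rw [Nat.testBit_zero]
      cases h : p s <;> simp [h]
    | succ i =>
      rw [Nat.testBit_succ]
      have : (2 * numberOf p l + (p s).toNat) / 2 = numberOf p l := by
        have := Bool.toNat_lt (p s)
        omega
      rw [this, ih]
      simp

open Classical in
/-- The choice of orbits of facets for a complex. -/
noncomputable def stateOf (K : AbstractSimplicialComplex W) : ℕ :=
  numberOf (fun s => decide (unmask s ∈ K)) orbitMasks

theorem orbitMasks_spec : ∀ s ∈ orbitMasks, s < 1024 ∧ size s = 4 := by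
  decide +kernel

/-- The clause about the digit `6` says that orbit `0`, the four-element subsets of `{1, …, 5}`,
misses that vertex; it is needed in `IsCandidate.one_lt_stateOf`. -/
theorem orbitIndex_spec : ∀ s < 1024, size s = 4 →
    (orbitIndex s = 31 ∧ 3 ≤ size (s &&& 961)) ∨
    (s ∈ translates orbitMasks ∧ (s.testBit 6 = true → orbitIndex s ≠ 0) ∧
      ∃ n < 5, orbitMasks[orbitIndex s]? = some (imageMask (rotate n) s)) := by
  decide +kernel

theorem translates_orbitMasks_spec : ∀ s ∈ translates orbitMasks, s < 1024 ∧ size s = 4 := by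
  decide +kernel

variable {K : AbstractSimplicialComplex W}

theorem IsSimplicialAction.image_mem_iff (hK : IsSimplicialAction C5 K) (g : C5) (σ : Finset W) :
    σ.image (fun x => g • x) ∈ K ↔ σ ∈ K := by
  refine ⟨fun h => ?_, hK g σ⟩
  have := hK g⁻¹ _ h
  rw [Finset.image_image] at this
  convert this
  ext x
  simp

theorem testBit_stateOf_lt {i : ℕ} (h : (stateOf K).testBit i = true) : i < 31 := by
  rw [stateOf, testBit_numberOf] at h
  by_contra hi
  rw [List.getElem?_eq_none (not_lt.1 hi)] at h
  simp at h

/-- By invariance, membership depends only on the orbit. A set with index `31` would contain a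
triangle of the second orbit, so it is not a face, and the state has no digit at `31` either. -/
theorem IsCandidate.mem_iff (hK : IsCandidate K) {σ : Finset W} (hσ : σ.card = 4) :
    σ ∈ K ↔ (stateOf K).testBit (orbitIndex (mask σ)) = true := by
  classical
  rcases orbitIndex_spec (mask σ) (mask_lt σ) (by rw [size_mask, hσ]) with
    ⟨h1, h2⟩ | ⟨-, -, n, hn, h⟩
  · refine iff_of_false (fun hm => ?_) (fun hm => ?_)
    · rw [← mask_secondOrbit, ← mask_inter, size_mask] at h2
      obtain ⟨τ, hτ, h3⟩ := Finset.exists_subset_card_eq h2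
      refine hK.no_triangle τ ?_ h3 (hτ.trans Finset.inter_subset_right)
      exact (K.isRelLowerSet_faces hm).2 (hτ.trans Finset.inter_subset_left)
        (Finset.card_pos.1 (by omega))
    · have := testBit_stateOf_lt hm
      omega
  · rw [stateOf, testBit_numberOf, h]
    have hr := mask_image (fun x => rotate_eq (Multiplicative.ofAdd (n : ZMod 5)) x) σ
    rw [toAdd_ofAdd, ZMod.val_natCast_of_lt hn] at hr
    rw [← hr, Option.map_some, Option.getD_some, decide_eq_true_iff, unmask_mask]
    exact (hK.simplicial.image_mem_iff _ σ).symm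

theorem count_cons (x j : ℕ) (r : List ℕ) :
    count x (j :: r) = (x.testBit j).toNat + count x r := by
  change digit x j + count x r = _
  rw [digit_eq]

theorem IsCandidate.count_rowOn (hK : IsCandidate K) {σ : Finset W} (hσ : σ.card = 3) :
    count (stateOf K) (rowOn (mask σ) vertices) =
      {v | v ∉ σ ∧ insert v σ ∈ K.toPreAbstractSimplicialComplex}.ncard := by
  classical
  have key : ∀ l : List W, count (stateOf K) (rowOn (mask σ) (l.map Fin.val)) =
      (l.map fun v => if v ∉ σ ∧ insert v σ ∈ K then 1 else 0).sum := by
    intro l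
    induction l with
    | nil => rfl
    | cons v l ih =>
      rw [List.map_cons, List.map_cons, List.sum_cons, ← ih]
      change count _ (bif bit (mask σ) v.val then rowOn (mask σ) (l.map Fin.val) else
        bif Nat.ble 31 (orbitIndex (mask σ ||| 1 <<< v.val)) then rowOn (mask σ) (l.map Fin.val)
        else orbitIndex (mask σ ||| 1 <<< v.val) :: rowOn (mask σ) (l.map Fin.val)) = _
      rw [bit_eq_testBit, testBit_mask, ← mask_insert]
      by_cases hv : v ∈ σ
      · simp [hv]
      · have hm := hK.mem_iff (σ := insert v σ) (by rw [Finset.card_insert_of_notMem hv, hσ])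
        simp only [hv, decide_false, cond_false, not_false_eq_true, true_and]
        cases h31 : Nat.ble 31 (orbitIndex (mask (insert v σ)))
        · rw [cond_false, count_cons]
          congr 1
          by_cases h : insert v σ ∈ K
          · rw [if_pos h, hm.1 h, Bool.toNat_true]
          · rw [if_neg h, Bool.eq_false_iff.2 fun h' => h (hm.2 h'), Bool.toNat_false]
        -- A tetrahedron omitted from the row has an index beyond the digits of the state, so it is
        -- not a face and contributes nothing.
        · rw [cond_true, if_neg, zero_add]
          intro h
          have := testBit_stateOf_lt (hm.1 h)
          have := Nat.le_of_ble_eq_true h31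
          omega
  have hv : vertices = (List.finRange 10).map Fin.val := by decide
  rw [hv, key, ← Fin.sum_univ_def, Finset.sum_boole, Nat.cast_id,
    ← Set.ncard_coe_finset, Finset.coe_filter]
  simp only [Finset.mem_univ, true_and]
  rfl

theorem IsCandidate.count_row (hK : IsCandidate K) {r : List ℕ} (hr : r ∈ rows) :
    count (stateOf K) r = 0 ∨ count (stateOf K) r = 2 := by
  rw [← map_rowOn_triangleMasks, List.mem_map] at hr
  obtain ⟨s, hs, rfl⟩ := hr
  have hs' : ∀ s ∈ triangleMasks, s < 1024 ∧ size s = 3 := by decide +kernel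
  obtain ⟨h1, h2⟩ := hs' s hs
  obtain ⟨σ, rfl⟩ := mask_lt_iff_exists.1 h1
  rw [size_mask] at h2
  rw [hK.count_rowOn h2]
  by_cases hσ : σ ∈ K
  · exact Or.inr (hK.sphereLike.triangle σ hσ h2)
  · left
    rw [Set.ncard_eq_zero, Set.eq_empty_iff_forall_notMem]
    rintro v ⟨-, hv⟩
    exact hσ ((K.isRelLowerSet_faces hv).2 (Finset.subset_insert _ _)
      (Finset.card_pos.1 (by omega)))

/-- Truncation can only lower a count, so it stays at most two. If no index of the row exceeds `k`,
the count is already final and hence different from one. -/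
theorem isConsistent_mod {x : ℕ} (hx : ∀ r ∈ rows, count x r = 0 ∨ count x r = 2) (k : ℕ) :
    isConsistent k (x % 2 ^ (k + 1)) = true := by
  rw [isConsistent, allOf_eq_true]
  intro r hr
  have hr' : r ∈ rows := by
    have : ∀ l : List (List ℕ), r ∈ (List.rec [] (fun r _ ih =>
        bif anyOf (Nat.beq k) r then r :: ih else ih) l : List (List ℕ)) → r ∈ l := by
      intro l
      induction l with
      | nil => exact id
      | cons a l ih =>
        dsimp only
        cases anyOf (Nat.beq k) a
        · exact fun h => List.mem_cons_of_mem _ (ih h)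
        · rw [cond_true, List.mem_cons, List.mem_cons]
          exact Or.imp_right ih
    exact this rows hr
  have hle : ∀ r : List ℕ, count (x % 2 ^ (k + 1)) r ≤ count x r := by
    intro r
    induction r with
    | nil => exact le_rfl
    | cons j r ih =>
      rw [count_cons, count_cons, Nat.testBit_mod_two_pow]
      have : (decide (j < k + 1) && x.testBit j).toNat ≤ (x.testBit j).toNat := by
        cases decide (j < k + 1) <;> simp
      omega
  have heq : ∀ r : List ℕ, (∀ j ∈ r, j ≤ k) → count (x % 2 ^ (k + 1)) r = count x r := by
    intro r
    induction r with
    | nil => exact fun _ => rfl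
    | cons j r ih =>
      intro h
      rw [count_cons, count_cons, ih fun i hi => h i (by simp [hi]), Nat.testBit_mod_two_pow,
        decide_eq_true (Nat.lt_succ_of_le (h j (by simp))), Bool.true_and]
  have h2 := hx r hr'
  have h3 := hle r
  rw [Bool.and_eq_true]
  refine ⟨Nat.ble_eq_true_of_le (by omega), ?_⟩
  rw [Bool.or_eq_true]
  by_cases h : ∀ j ∈ r, j ≤ k
  · left
    rw [heq r h]
    rcases h2 with h2 | h2 <;> rw [h2] <;> rfl
  · right
    push Not at h
    obtain ⟨j, hj, hjk⟩ := h
    rw [anyOf_eq_true]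
    exact ⟨j, hj, Nat.ble_eq_true_of_le hjk⟩

/-- The truncations of `x` trace one branch of the search tree, and by `isConsistent_mod` this
branch is never pruned. -/
theorem search_sound {p : ℕ → Bool} {x : ℕ} (hx : ∀ r ∈ rows, count x r = 0 ∨ count x r = 2)
    (n : ℕ) : ∀ k, search p (List.range' k n) (x % 2 ^ k) = true → p (x % 2 ^ (k + n)) = true := by
  induction n with
  | zero => exact fun k h => h
  | succ n ih =>
    intro k h
    rw [List.range'_succ] at h
    change Bool.and (bif isConsistent k (x % 2 ^ k) then
      search p (List.range' (k + 1) n) (x % 2 ^ k) else true) (force (x % 2 ^ k ||| 1 <<< k) fun m =>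
        bif isConsistent k m then search p (List.range' (k + 1) n) m else true) = true at h
    rw [Bool.and_eq_true, force_eq] at h
    have h0 := isConsistent_mod hx k
    have hbit : x % 2 ^ (k + 1) = if x.testBit k then x % 2 ^ k ||| 1 <<< k else x % 2 ^ k := by
      refine Nat.eq_of_testBit_eq fun i => ?_
      split_ifs with hk
      · rw [Nat.testBit_or, Nat.testBit_mod_two_pow, Nat.testBit_mod_two_pow,
          testBit_one_shiftLeft]
        rcases lt_trichotomy i k with hi | rfl | hi
        · simp [hi, hi.ne, Nat.lt_succ_of_lt hi]
        · simp [hk]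
        · simp [hi.ne', hi.not_gt, show ¬ i < k + 1 by omega]
      · rw [Nat.testBit_mod_two_pow, Nat.testBit_mod_two_pow]
        rcases lt_trichotomy i k with hi | rfl | hi
        · simp [hi, Nat.lt_succ_of_lt hi]
        · simp [hk]
        · simp [hi.not_gt, show ¬ i < k + 1 by omega]
    have key : search p (List.range' (k + 1) n) (x % 2 ^ (k + 1)) = true := by
      rw [hbit] at h0 ⊢
      split_ifs at h0 ⊢
      · rw [h0, cond_true] at h
        exact h.2
      · rw [h0, cond_true] at h
        exact h.1
    have := ih (k + 1) key
    rwa [show k + 1 + n = k + (n + 1) by omega] at this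

theorem IsCandidate.isKnown_stateOf (hK : IsCandidate K) : isKnown (stateOf K) = true := by
  have hl : levels = List.range' 0 31 := by decide
  have h := search_isKnown
  rw [hl] at h
  have h' := search_sound (p := isKnown) (x := stateOf K) (fun r hr => hK.count_row hr) 31 0
    (by rwa [pow_zero, Nat.mod_one])
  rwa [Nat.mod_eq_of_lt] at h'
  refine Nat.lt_pow_two_of_testBit _ fun i hi => ?_
  rw [Bool.eq_false_iff]
  intro h
  have := testBit_stateOf_lt h
  omega

theorem IsCandidate.stateOf_comap (hK : IsCandidate K) {f : W ≃ W} {k t : ℕ}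
    (hf : ∀ x : W, relabel k t x.val = (f x).val) :
    stateOf (EquivariantComplex.comap f K) = relabelState (orbitPermutation k t) (stateOf K) := by
  classical
  have h : ∀ l : List ℕ, relabelState (List.rec [] (fun s _ ih =>
      orbitIndex (imageMask (relabel k t) s) :: ih) l) (stateOf K) =
      numberOf (fun s => (stateOf K).testBit (orbitIndex (imageMask (relabel k t) s))) l := by
    intro l
    induction l with
    | nil => rfl
    | cons s l ih =>
      rw [numberOf_cons, ← ih, ← digit_eq]
      rfl
  rw [orbitPermutation, h, stateOf]
  refine numberOf_congr fun s hs => ?_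
  obtain ⟨h1, h2⟩ := orbitMasks_spec s hs
  obtain ⟨σ, rfl⟩ := mask_lt_iff_exists.1 h1
  rw [size_mask] at h2
  rw [unmask_mask, Bool.eq_iff_iff, decide_eq_true_iff, mem_comap, ← mask_image hf,
    hK.mem_iff (by rw [Finset.card_map, h2]), Finset.map_eq_image]
  rfl

theorem stateOf_L (i : Fin 9) : stateOf (L i) = stateL i := by
  classical
  refine numberOf_congr fun s hs => ?_
  obtain ⟨h1, h2⟩ := orbitMasks_spec s hs
  obtain ⟨σ, rfl⟩ := mask_lt_iff_exists.1 h1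
  rw [size_mask] at h2
  rw [Bool.eq_iff_iff, decide_eq_true_iff, unmask_mask, mem_L_iff, anyOf_eq_true]
  simp only [Nat.beq_eq]
  exact ⟨And.right, fun h => ⟨Finset.card_pos.1 (by omega), h⟩⟩

/-- The state determines the tetrahedra, and by purity these determine the complex. -/
theorem IsCandidate.eq_of_stateOf_eq {M : AbstractSimplicialComplex W} (hK : IsCandidate K)
    (hM : IsCandidate M) (h : stateOf K = stateOf M) : K = M := by
  have key : ∀ {K M : AbstractSimplicialComplex W}, IsCandidate K → IsCandidate M →
      stateOf K = stateOf M → ∀ σ ∈ K, σ ∈ M := by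
    intro K M hK hM h σ hσ
    obtain ⟨τ, hτ, hsub, h4⟩ := hK.sphereLike.pure σ hσ
    have hτM : τ ∈ M := by
      rw [hM.mem_iff h4, ← h, ← hK.mem_iff h4]
      exact hτ
    exact (M.isRelLowerSet_faces hτM).2 hsub (K.isRelLowerSet_faces hσ).1
  exact SetLike.ext fun σ => ⟨key hK hM h σ, key hM hK h.symm σ⟩

/-- By purity the vertex `6` lies in a tetrahedron. Its orbit is not orbit `0`, so some digit other
than the lowest one is set. -/
theorem IsCandidate.one_lt_stateOf (hK : IsCandidate K) : 1 < stateOf K := by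
  obtain ⟨τ, hτ, hsub, h4⟩ := hK.sphereLike.pure {6} (K.singleton_mem 6)
  have hbit := (hK.mem_iff h4).1 hτ
  have h6 : (mask τ).testBit 6 = true := by
    rw [show 6 = (6 : W).val from rfl, testBit_mask]
    simpa using hsub
  have hne : orbitIndex (mask τ) ≠ 0 := by
    rcases orbitIndex_spec (mask τ) (mask_lt τ) (by rw [size_mask, h4]) with ⟨h, -⟩ | ⟨-, h, -⟩
    · rw [h]
      norm_num
    · exact h h6
  by_contra hle
  have hlt : stateOf K < 2 ^ orbitIndex (mask τ) :=
    lt_of_lt_of_le (by omega : stateOf K < 2 ^ 1) (Nat.pow_le_pow_right two_pos (by omega))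
  rw [Nat.testBit_lt_two_pow hlt] at hbit
  exact absurd hbit (by simp)

theorem mem_elements {s v : ℕ} : v ∈ elements s ↔ v < 10 ∧ s.testBit v = true := by
  have : elements s = vertices.filter fun v => s.testBit v := by
    rw [elements]
    generalize vertices = l
    induction l with
    | nil => rfl
    | cons x l ih =>
      rw [List.filter_cons, ← ih]
      simp only [bit_eq_testBit]
      cases s.testBit x <;> rfl
  rw [this, List.mem_filter, mem_vertices]

theorem mask_pair_union (σ : Finset W) (x y : W) :
    mask ({x, y} ∪ σ) = pairMask (mask σ) x.val y.val := by
  rw [mask_union, mask_insert, mask_singleton]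
  change _ = 1 <<< x.val ||| (1 <<< y.val ||| mask σ)
  rw [Nat.or_comm (1 <<< y.val), Nat.or_assoc]

theorem IsCandidate.mem_of_isFace (hK : IsCandidate K) {σ : Finset W} (hσ : σ.Nonempty)
    (h : isFace (stateOf K) (mask σ) = true) : σ ∈ K := by
  obtain ⟨f, hf, h⟩ := anyOf_eq_true.1 h
  rw [Bool.and_eq_true, bit_eq_testBit] at h
  obtain ⟨h1, h2⟩ := translates_orbitMasks_spec f hf
  obtain ⟨τ, rfl⟩ := mask_lt_iff_exists.1 h1
  rw [size_mask] at h2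
  exact (K.isRelLowerSet_faces ((hK.mem_iff h2).2 h.1)).2
    (land_mask_eq_right.1 (Nat.eq_of_beq_eq_true h.2)) hσ

theorem isBalanced_iff {P x y z : ℕ} : isBalanced P x y z = true ↔
    ((digit P (10 * x + y) : ℤ) - digit P (10 * y + x)) +
    (digit P (10 * y + z) - digit P (10 * z + y)) +
    (digit P (10 * z + x) - digit P (10 * x + z)) = 0 := by
  rw [isBalanced, Nat.beq_eq]
  change digit P (10 * x + y) + digit P (10 * y + z) + digit P (10 * z + x) =
    digit P (10 * y + x) + digit P (10 * z + y) + digit P (10 * x + z) ↔ _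
  omega

/-- With this state the data of `o` would be a cocycle on the link of `face` with nonzero period,
contrary to `IsSphereLike.period`. -/
theorem IsCandidate.stateOf_ne_of_isObstruction (hK : IsCandidate K) {o : Obstruction}
    (h : isObstruction o = true) : stateOf K ≠ o.state := by
  intro hs
  rw [isObstruction, foldThen_eq] at h
  generalize List.foldl _ 0 o.cocycle = P at h
  obtain ⟨state, face, cocycle, x, y, z⟩ := o
  dsimp only at h hs
  subst hs
  simp only [Bool.and_eq_true, Bool.not_eq_true', allOf_eq_true, List.forall_mem_cons,
    List.not_mem_nil, false_imp_iff, implies_true, and_true, Nat.blt_eq, Nat.ble_eq] at h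
  obtain ⟨⟨hface, hsize⟩, hcoc, hbal, ⟨⟨hx, hxs⟩, ⟨hy, hys⟩, hz, hzs⟩, ⟨hxy, hyz, hzx⟩,
    fxy, fyz, fzx⟩ := h
  obtain ⟨σ, rfl⟩ := mask_lt_iff_exists.1 hface
  rw [size_mask] at hsize
  have hlift : ∀ v, v < 10 → bit (mask σ) v = false → ∃ w : W, w.val = v ∧ w ∉ σ := by
    intro v hv hvs
    rw [bit_eq_testBit] at hvs
    refine ⟨⟨v, hv⟩, rfl, fun hm => ?_⟩
    rw [show v = (⟨v, hv⟩ : W).val from rfl, testBit_mask, decide_eq_true hm] at hvs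
    exact absurd hvs (by simp)
  obtain ⟨x, rfl, hxσ⟩ := hlift x hx hxs
  obtain ⟨y, rfl, hyσ⟩ := hlift y hy hys
  obtain ⟨z, rfl, hzσ⟩ := hlift z hz hzs
  have hne : ∀ x y : W, Nat.beq x.val y.val = false → x ≠ y := by
    rintro x _ h rfl
    rw [Nat.beq_refl] at h
    exact absurd h (by simp)
  rw [← mask_pair_union] at fxy fyz fzx
  have hnonempty : ∀ x y : W, (({x, y} : Finset W) ∪ σ).Nonempty := fun x y =>
    ⟨x, by simp⟩
  let c : W → W → ℤ := fun x y => digit P (10 * x.val + y.val) - digit P (10 * y.val + x.val)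
  have hσ : σ = ∅ ∨ σ ∈ K.toPreAbstractSimplicialComplex := by
    rcases Nat.eq_zero_or_pos σ.card with h0 | h0
    · exact Or.inl (Finset.card_eq_zero.1 h0)
    · obtain ⟨v, rfl⟩ := Finset.card_eq_one.1 (le_antisymm hsize h0)
      exact Or.inr (K.singleton_mem v)
  have h0 := hK.sphereLike.period σ hsize hσ c (fun x y => by simp only [c]; ring)
    (fun x y z hd hm => by
      -- By purity it suffices that the cocycle condition was checked for all triples of vertices in
      -- `τ \ σ`, for each tetrahedron `τ` containing `σ`.
      obtain ⟨τ, hτ, hsub, h4⟩ := hK.sphereLike.pure _ hm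
      have hτ' := (hK.mem_iff h4).1 hτ
      have hmem : mask τ ∈ translates orbitMasks := by
        rcases orbitIndex_spec (mask τ) (mask_lt τ) (by rw [size_mask, h4]) with h | h
        · have := testBit_stateOf_lt hτ'
          omega
        · exact h.1
      have hστ : σ ⊆ τ := Finset.subset_union_right.trans hsub
      have h5 := allOf_eq_true.1 hcoc _ hmem
      have h6 : Nat.beq (Nat.land (mask τ) (mask σ)) (mask σ) = true := by
        rw [Nat.beq_eq]
        exact land_mask_eq_right.2 hστ
      rw [bit_eq_testBit, hτ', h6] at h5
      have hel : ∀ v : W, v ∈ ({x, y, z} : Finset W) →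
          v.val ∈ elements (Nat.xor (mask τ) (mask σ)) := by
        intro v hv
        rw [mem_elements]
        refine ⟨v.isLt, ?_⟩
        change (mask τ ^^^ mask σ).testBit v.val = true
        rw [Nat.testBit_xor, testBit_mask, testBit_mask,
          decide_eq_true (hsub (Finset.mem_union_left _ hv)),
          decide_eq_false (Finset.disjoint_left.1 hd hv)]
        rfl
      have h7 := allOf_eq_true.1 (allOf_eq_true.1 (allOf_eq_true.1 h5 _ (hel x (by simp))) _
        (hel y (by simp))) _ (hel z (by simp))
      exact isBalanced_iff.1 h7)
    x y z (hne _ _ hxy) (hne _ _ hyz) (hne _ _ hzx) (by simp [hxσ, hyσ, hzσ])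
    (hK.mem_of_isFace (hnonempty _ _) fxy) (hK.mem_of_isFace (hnonempty _ _) fyz)
    (hK.mem_of_isFace (hnonempty _ _) fzx)
  rw [isBalanced_iff.2 h0] at hbal
  exact absurd hbal (by simp)

theorem IsCandidate.exists_weaklyIsomorphic_L (hK : IsCandidate K) :
    ∃ i, WeaklyIsomorphic C5 K (L i) := by
  have h := hK.isKnown_stateOf
  rw [isKnown, Bool.or_eq_true] at h
  rcases h with h | h
  · have := hK.one_lt_stateOf
    have := Nat.le_of_ble_eq_true h
    omega
  · obtain ⟨k, hk, h⟩ := anyOf_eq_true.1 h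
    obtain ⟨t, ht, h⟩ := anyOf_eq_true.1 h
    obtain ⟨f, φ, hf, hφ, hs⟩ := exists_relabel_equiv hk ht
    have hM := hK.comap hφ hs
    rw [force_eq, ← hK.stateOf_comap hf, Bool.or_eq_true, anyOf_eq_true, anyOf_eq_true] at h
    rcases h with ⟨i, -, h⟩ | ⟨o, ho, h⟩
    · have := hM.eq_of_stateOf_eq (isCandidate_L i)
        ((Nat.eq_of_beq_eq_true h).trans (stateOf_L i).symm)
      exact ⟨i, this ▸ weaklyIsomorphic_comap hφ K⟩
    · exact absurd (Nat.eq_of_beq_eq_true h)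
        (hM.stateOf_ne_of_isObstruction (isObstruction_of_mem o ho))

end Classification

/-! ### The nine complexes are pairwise not weakly isomorphic. -/

section NotIsomorphic

/-- The map of vertices, as natural numbers, that is equivariant up to the `k`-th power and takes
`1` to `p` and `6` to `q`. -/
def label (k p q x : ℕ) : ℕ :=
  rotate (Nat.mod (Nat.mul (Nat.mod (Nat.add x 4) 5) k) 5)
    (bif Nat.ble 5 (Nat.mod (Nat.add x 4) 10) then p else q)

/-- Check that no map given by `label` takes the facets of `L i` to facets of `L j`. -/
noncomputable def isDistinct (i j : Fin 9) : Bool :=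
  foldThen (fun N s => Nat.lor N (Nat.shiftLeft 1 s)) (fun N =>
    allOf (fun k => allOf (fun p => allOf (fun q => anyOf (fun s =>
      Bool.not (bit N (imageMask (label k p q) s))) (representativeMasks i))
      vertices) [1, 6]) [1, 2, 3, 4]) (translates (representativeMasks j)) 0

/-- For each pair 4 · 2 · 10 maps are tested. Some of them are not injective, which does no harm. -/
theorem isDistinct_of_ne : ∀ i j, i ≠ j → isDistinct i j = true := by
  decide +kernel

/-- Every vertex is a translate of `1` or `6`, so a map that is equivariant up to the `k`-th power
is determined by its values there. -/
theorem label_eq {f : W → W} {k : ℕ} (hk : k ∈ [1, 2, 3, 4])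
    (hf : ∀ (g : C5) (x : W), f (g • x) = g ^ k • f x) (x : W) :
    label k (f 1).val (f 6).val x.val = (f x).val := by
  have key : ∀ k ∈ [1, 2, 3, 4], ∀ x : W,
      x = Multiplicative.ofAdd (position x) •
        (if Nat.ble 5 (Nat.mod (Nat.add x.val 4) 10) = true then 1 else 6 : W) ∧
      Nat.mod (Nat.mul (Nat.mod (Nat.add x 4) 5) k) 5 =
        (Multiplicative.toAdd (Multiplicative.ofAdd (position x) ^ k)).val := by
    decide +kernel
  obtain ⟨h1, h2⟩ := key k hk x
  rw [label, h2]
  conv_rhs => rw [h1]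
  rw [hf, ← rotate_eq]
  cases Nat.ble 5 (Nat.mod (Nat.add x.val 4) 10) <;> rfl

theorem exists_forall_eq_pow (φ : C5 ≃* C5) : ∃ k ∈ [1, 2, 3, 4], ∀ g, φ g = g ^ k := by
  have h1 : ∀ g : C5, g = Multiplicative.ofAdd 1 ^ (Multiplicative.toAdd g).val := by
    decide +kernel
  have h2 : ∀ a g : C5, a ^ (Multiplicative.toAdd g).val = g ^ (Multiplicative.toAdd a).val := by
    decide +kernel
  have h3 : ∀ a : C5, a ≠ 1 → (Multiplicative.toAdd a).val ∈ [1, 2, 3, 4] := by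
    decide +kernel
  refine ⟨_, h3 (φ (Multiplicative.ofAdd 1)) ?_, fun g => ?_⟩
  · rw [Ne, EmbeddingLike.map_eq_one_iff]
    decide
  · conv_lhs => rw [h1 g]
    rw [map_pow, h2]

theorem eq_of_weaklyIsomorphic_L {i j : Fin 9} (h : WeaklyIsomorphic C5 (L i) (L j)) : i = j := by
  by_contra hij
  obtain ⟨f, φ, hf, hφ⟩ := h
  obtain ⟨k, hk, hφk⟩ := exists_forall_eq_pow φ
  -- Since `L j` is invariant and `C5` is commutative, `f` may be replaced by `g • f`, which leaves
  -- two choices for the image of `1`. The two orbits may be interchanged.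
  obtain ⟨g, hg⟩ : ∃ g : C5, (g • f 1).val ∈ [1, 6] := by
    have : ∀ x : W, ∃ g : C5, (g • x).val ∈ [1, 6] := by decide +kernel
    exact this _
  have hequiv : ∀ (h : C5) (x : W), g • f (h • x) = h ^ k • g • f x := by
    intro h x
    rw [hφ, hφk, smul_smul, smul_smul, mul_comm]
  have hd := isDistinct_of_ne i j hij
  rw [isDistinct, foldThen_eq] at hd
  obtain ⟨s, hs, hd⟩ := anyOf_eq_true.1 (allOf_eq_true.1 (allOf_eq_true.1 (allOf_eq_true.1 hd k hk)
    _ hg) _ (mem_vertices.2 (g • f 6).isLt))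
  obtain ⟨τ, hτ, rfl⟩ := (mem_representativeMasks i s).1 hs
  rw [← mask_image (label_eq (f := fun x => g • f x) hk hequiv), bit_eq_testBit, Bool.not_eq_true',
    ← Bool.not_eq_true, testBit_foldl_lor] at hd
  apply hd
  right
  have hcard : ∀ i, ∀ τ ∈ representatives i, τ.card = 4 := by
    decide +kernel
  have hτL : τ ∈ L i := ⟨Finset.card_pos.1 (by rw [hcard i τ hτ]; norm_num), τ, hτ, 1, by simp⟩
  have himage : (τ.image fun x => g • f x) ∈ L j := by
    have := isSimplicialAction_L j g _ ((hf τ).1 hτL)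
    rwa [Finset.map_eq_image, Finset.image_image] at this
  -- The image of `τ` is a face of `L j` contained in a listed facet; both have four vertices, so
  -- they are equal.
  obtain ⟨-, u, hu, huτ⟩ := (mem_L_iff j _).1 himage
  obtain ⟨h1, h2, -⟩ := facets_L j u hu
  obtain ⟨ρ, rfl⟩ := mask_lt_iff_exists.1 h1
  rw [size_mask] at h2
  rw [land_mask_eq_right] at huτ
  rwa [Finset.eq_of_subset_of_card_le huτ]
  have hinj : Function.Injective fun x => g • f x := (MulAction.injective g).comp f.injective
  rw [h2, Finset.card_image_of_injective _ hinj, hcard i τ hτ]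

end NotIsomorphic

end EquivariantComplex

theorem proposition5p2 :
    (∀ i : Fin 9, EquivariantComplex.IsTwoOrbitSphere (EquivariantComplex.L i)) ∧
    (∀ i j : Fin 9, EquivariantComplex.WeaklyIsomorphic EquivariantComplex.C5
      (EquivariantComplex.L i) (EquivariantComplex.L j) → i = j) ∧
    (∀ (V : Type u) [Fintype V] [DecidableEq V] [MulAction EquivariantComplex.C5 V]
      (K : AbstractSimplicialComplex V), EquivariantComplex.IsTwoOrbitSphere K →
      ∃ i : Fin 9, EquivariantComplex.WeaklyIsomorphic EquivariantComplex.C5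
        K (EquivariantComplex.L i)) := by
  refine ⟨EquivariantComplex.isTwoOrbitSphere_L,
    fun i j => EquivariantComplex.eq_of_weaklyIsomorphic_L, ?_⟩
  intro V _ _ _ K hK
  obtain ⟨M, hM, hKM⟩ := hK.exists_isCandidate
  obtain ⟨i, hi⟩ := hM.exists_weaklyIsomorphic_L
  exact ⟨i, hKM.trans hi⟩
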